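/- Let $G$ be a topological group (for example, a locally compact, $\sigma$-compact amenable group). A *system* $X=(X,\mathcal X,\mu,T_1,T_2)$ consists of a second countable Hausdorff space $X$ with its Borel $\sigma$-algebra $\mathcal X$, a regular Borel probability measure $\mu$, and two (jointly) continuous measure-preserving left $G$-actions $T_1,T_2$ on $X$ that commute, i.e. $T_1^gT_2^h=T_2^hT_1^g$ $\mu$-a.e. for all $g,h\in G$. An *extension* $X'\to X$ is a continuous measure-preserving map from a system $X'$ to $X$ that intertwines the respective actions. Let $\mathcal I_i$ be the $\sigma$-algebra of measurable sets that are $T_i$-invariant modulo $\mu$-null sets. Let $\mathsf I$ be the class of systems with $\mathcal X=\mathcal I_1\vee\mathcal I_2$ modulo null sets, and for a system $X$ let $\mathsf I X$ be the maximal factor of $X$ in $\mathsf I$, a factor being a sub-$\sigma$-algebra of $\mathcal X$ that is invariant under both actions (in fact $\mathsf I X=\mathcal I_1\vee\mathcal I_2$). The system $X$ is *$\mathsf I$-sated* if for every extension $\pi:X'\to X$ the factors $\pi^{-1}(\mathcal X)$ and $\mathsf I X'$ of $X'$ are relatively independent over $\pi^{-1}(\mathsf I X)$: every $f\in L^2(X',\pi^{-1}(\mathcal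 X);\mathbb C)$ that is orthogonal to $L^2(X',\pi^{-1}(\mathsf I X))$ is orthogonal to $L^2(X',\mathsf I X')$. For a factor $\mathcal Y\subseteq\mathcal X$ let $A(X|\mathcal Y,T_1)\subseteq L^2(X;\mathbb C)$ be the closed linear span of all finite rank $T_1$-invariant $L^\infty(\mathcal Y)$-submodules of $L^\infty(X)$, that is, of all sets $M=\{\sum_{i=1}^r c_i\varphi_i : c_i\in L^\infty(\mathcal Y)\}$ with $r\in\mathbb N$ and $\varphi_1,\dots,\varphi_r\in L^\infty(X)$ such that $f\circ T_1^g\in M$ for all $f\in M$ and $g\in G$. **Proposition.** If $X$ is $\mathsf I$-sated, then $X$ is magic, that is, $$A(X|\mathcal I_2,T_1)=L^2(X,\mathcal I_1\vee\mathcal I_2,\mu).$$ -/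

import Mathlib

open MeasureTheory

universe u v

noncomputable section

namespace CommutingActions

/-- A `k`-tuple of commuting continuous measure-preserving (left) actions of a topological group
`G` on a regular Borel probability space. Second countability makes the measure algebra separable
and makes finite products of such spaces carry the product Borel structure. As usual, the actions
commute in the sense that `T i g ∘ T j h = T j h ∘ T i g` almost everywhere, for all `g` and `h`. -/
structure MPS (G : Type v) [Group G] [TopologicalSpace G] (k : ℕ) where
  carrier : Type u
  [topology : TopologicalSpace carrier]
  [t2Space : T2Space carrier]
  [secondCountable : SecondCountableTopology carrier]
  [measurableSpace : MeasurableSpace carrier]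
  [borelSpace : BorelSpace carrier]
  μ : Measure carrier
  [isProbabilityMeasure : IsProbabilityMeasure μ]
  [regular : μ.Regular]
  T : Fin k → G → carrier → carrier
  T_one : ∀ i x, T i 1 x = x
  T_mul : ∀ i g h x, T i (g * h) x = T i g (T i h x)
  T_continuous : ∀ i, Continuous fun p : G × carrier => T i p.1 p.2
  T_measurePreserving : ∀ i g, MeasurePreserving (T i g) μ μ
  T_commute : ∀ i j, i ≠ j → ∀ g h, ∀ᵐ x ∂μ, T i g (T j h x) = T j h (T i g x)

attribute [instance] MPS.topology MPS.t2Space MPS.secondCountable MPS.measurableSpace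
  MPS.borelSpace MPS.isProbabilityMeasure MPS.regular

section SingleAction

variable {G : Type v} {Ω : Type u}

/-- The σ-algebra of measurable sets that are invariant, modulo null sets, under every `T g`. -/
@[reducible] def invariantSigma [MeasurableSpace Ω] (μ : Measure Ω) (T : G → Ω → Ω) : MeasurableSpace Ω where
  MeasurableSet' A := MeasurableSet A ∧ ∀ g, T g ⁻¹' A =ᵐ[μ] A
  measurableSet_empty := ⟨MeasurableSet.empty, fun _ => by simp⟩
  measurableSet_compl A hA :=
    ⟨hA.1.compl, fun g => by simpa only [Set.preimage_compl] using (hA.2 g).compl⟩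
  measurableSet_iUnion A hA :=
    ⟨MeasurableSet.iUnion fun n => (hA n).1, fun g => by
      have hA' := Filter.EventuallyEq.countable_iUnion fun n => (hA n).2 g
      simpa only [Set.preimage_iUnion] using hA'⟩

/-- `φ` generates `M` over `L^∞(𝓨)`: the set `M` consists of the classes of the functions
`∑ i, c i * φ i`, where the coefficients `c i` are bounded and `𝓨`-measurable. -/
def GeneratesModule (𝓨 : MeasurableSpace Ω) [MeasurableSpace Ω] (μ : Measure Ω) {r : ℕ}
    (φ : Fin r → Ω → ℂ) (M : Set (Lp ℂ 2 μ)) : Prop :=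
  ∀ f : Lp ℂ 2 μ, f ∈ M ↔ ∃ c : Fin r → Ω → ℂ,
    (∀ i, MemLp (c i) ⊤ μ ∧ AEStronglyMeasurable[𝓨] (c i) μ) ∧
      f =ᵐ[μ] fun x => ∑ i, c i x * φ i x

/-- `M` is a `T`-invariant `L^∞(𝓨)`-submodule of `L^∞(Ω)` of finite rank: it is generated over
`L^∞(𝓨)` by finitely many elements of `L^∞(Ω)`, and `f ∘ T g ∈ M` for `f ∈ M` and all `g`. -/
def IsFiniteRankInvariantModule (𝓨 : MeasurableSpace Ω) [MeasurableSpace Ω] (μ : Measure Ω)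
    (T : G → Ω → Ω) (hT : ∀ g, MeasurePreserving (T g) μ μ) (M : Set (Lp ℂ 2 μ)) : Prop :=
  (∃ (r : ℕ) (φ : Fin r → Ω → ℂ), (∀ i, MemLp (φ i) ⊤ μ) ∧ GeneratesModule 𝓨 μ φ M) ∧
    ∀ g, ∀ f ∈ M, Lp.compMeasurePreserving (T g) (hT g) f ∈ M

/-- The space `A(Ω | 𝓨, T)` of relatively almost periodic functions: the closed linear subspace of
`L²(μ)` spanned by the `T`-invariant `L^∞(𝓨)`-submodules of `L^∞(Ω)` of finite rank. -/
def relAlmostPeriodic (𝓨 : MeasurableSpace Ω) [MeasurableSpace Ω] (μ : Measure Ω)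
    (T : G → Ω → Ω) (hT : ∀ g, MeasurePreserving (T g) μ μ) : Submodule ℂ (Lp ℂ 2 μ) :=
  (Submodule.span ℂ
    {f | ∃ M, IsFiniteRankInvariantModule 𝓨 μ T hT M ∧ f ∈ M}).topologicalClosure

/-- Relative independence of `𝓑₁` and `𝓑₂` over `𝓑`: every `f ∈ L²(𝓑₁)` that is orthogonal to
`L²(𝓑)` is orthogonal to `L²(𝓑₂)`. -/
def RelIndep (𝓑 𝓑₁ 𝓑₂ : MeasurableSpace Ω) [MeasurableSpace Ω] (μ : Measure Ω) : Prop :=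
  ∀ f ∈ lpMeas ℂ ℂ 𝓑₁ 2 μ, f ∈ (lpMeas ℂ ℂ 𝓑 2 μ)ᗮ → f ∈ (lpMeas ℂ ℂ 𝓑₂ 2 μ)ᗮ

end SingleAction

namespace MPS

variable {G : Type v} [Group G] [TopologicalSpace G] {k : ℕ}

/-- The σ-algebra of `T i`-invariant sets. -/
@[reducible] def inv (X : MPS.{u} G k) (i : Fin k) : MeasurableSpace X.carrier :=
  invariantSigma X.μ (X.T i)

/-- A factor of `X`, given as a sub-σ-algebra that is invariant under all the actions. -/
def IsFactor (X : MPS.{u} G k) (𝓑 : MeasurableSpace X.carrier) : Prop :=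
  𝓑 ≤ X.measurableSpace ∧ ∀ i g, Measurable[𝓑, 𝓑] (X.T i g)

/-- The factor `𝓑` belongs to the class of systems whose σ-algebra is generated, modulo null sets,
by the σ-algebras of `T i`-invariant sets: every set in `𝓑` agrees up to a null set with one in
the σ-algebra generated by the sets in `𝓑` that are invariant under some `T i`. -/
def FactorInInvClass (X : MPS.{u} G k) (𝓑 : MeasurableSpace X.carrier) : Prop :=
  ∀ A, MeasurableSet[𝓑] A → ∃ B, MeasurableSet[⨆ i, (X.inv i ⊓ 𝓑)] B ∧ A =ᵐ[X.μ] B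

/-- The maximal factor of `X` in the class of systems whose σ-algebra is generated by the
σ-algebras of `T i`-invariant sets. -/
@[reducible] def maxInvFactor (X : MPS.{u} G k) : MeasurableSpace X.carrier :=
  sSup {𝓑 | X.IsFactor 𝓑 ∧ X.FactorInInvClass 𝓑}

theorem measurable_T_inv (X : MPS.{u} G k) (i j : Fin k) (g : G) :
    Measurable[X.inv i, X.inv i] (X.T j g) := by
  intro A hA
  refine ⟨(X.T_measurePreserving j g).measurable hA.1, fun h => ?_⟩
  by_cases hij : i = j
  · subst hij
    have h1 : X.T i h ⁻¹' (X.T i g ⁻¹' A) = X.T i (g * h) ⁻¹' A := by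
      ext x
      simp only [Set.mem_preimage, X.T_mul]
    rw [h1]
    exact (hA.2 _).trans (hA.2 _).symm
  · have h1 : X.T i h ⁻¹' (X.T j g ⁻¹' A) =ᵐ[X.μ] X.T j g ⁻¹' (X.T i h ⁻¹' A) := by
      filter_upwards [X.T_commute i j hij h g] with x hx
      change (X.T j g (X.T i h x) ∈ A) = (X.T i h (X.T j g x) ∈ A)
      rw [hx]
    exact h1.trans ((X.T_measurePreserving j g).quasiMeasurePreserving.preimage_ae_eq (hA.2 h))

theorem iSup_inv_mem_invClass (X : MPS.{u} G k) :
    X.IsFactor (⨆ i, X.inv i) ∧ X.FactorInInvClass (⨆ i, X.inv i) := by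
  refine ⟨⟨iSup_le fun i A hA => hA.1, fun i g => ?_⟩, fun A hA => ⟨A, ?_, ae_eq_refl _⟩⟩
  · rw [measurable_iff_comap_le, MeasurableSpace.comap_iSup]
    exact iSup_mono fun j => (X.measurable_T_inv j i g).comap_le
  · exact iSup_mono (fun i => le_inf le_rfl (le_iSup X.inv i)) A hA

/-- For at least one action, the maximal factor in the class is the σ-algebra generated by the
σ-algebras of `T i`-invariant sets. -/
theorem maxInvFactor_eq [NeZero k] (X : MPS.{u} G k) : X.maxInvFactor = ⨆ i, X.inv i := by
  have hm : (⨆ i, X.inv i) ≤ X.measurableSpace := X.iSup_inv_mem_invClass.1.1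
  have hnull : ∀ N, MeasurableSet N → X.μ N = 0 → MeasurableSet[⨆ i, X.inv i] N := by
    intro N hN h0
    refine le_iSup X.inv 0 N ⟨hN, fun g => ?_⟩
    have h2 : X.μ (X.T 0 g ⁻¹' N) = 0 := by
      rw [(X.T_measurePreserving 0 g).measure_preimage hN.nullMeasurableSet, h0]
    exact (ae_eq_empty.2 h2).trans (ae_eq_empty.2 h0).symm
  refine le_antisymm (sSup_le fun 𝓑 h𝓑 A hA => ?_) (le_sSup X.iSup_inv_mem_invClass)
  obtain ⟨B, hB, hAB⟩ := h𝓑.2 A hA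
  have hB' : MeasurableSet[⨆ i, X.inv i] B :=
    (iSup_mono fun _ => inf_le_left : ⨆ i, (X.inv i ⊓ 𝓑) ≤ ⨆ i, X.inv i) B hB
  have hd := ae_eq_set.1 hAB
  have hAm := h𝓑.1.1 A hA
  have e : A = (B \ (B \ A)) ∪ (A \ B) := by
    ext x
    simp only [Set.mem_union, Set.mem_sdiff]
    tauto
  rw [e]
  exact MeasurableSet.union (hB'.diff (hnull _ ((hm B hB').diff hAm) hd.2))
    (hnull _ (hAm.diff (hm B hB')) hd.1)

/-- Morphisms `X' → X`, i.e. extensions of `X`: continuous measure-preserving maps that intertwine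
the respective actions. -/
structure IsFactorMap (X' X : MPS.{u} G k) (π : X'.carrier → X.carrier) : Prop where
  continuous : Continuous π
  measurePreserving : MeasurePreserving π X'.μ X.μ
  intertwines : ∀ i g x, π (X'.T i g x) = X.T i g (π x)

/-- `X` is sated for the class of systems generated by invariant sets: for every extension `X'` of
`X`, the factors `X` and `maxInvFactor X'` of `X'` are relatively independent over
`maxInvFactor X`. -/
def IsInvSated (X : MPS.{u} G k) : Prop :=
  ∀ (X' : MPS.{u} G k) (π : X'.carrier → X.carrier), IsFactorMap X' X π →
    RelIndep (X.maxInvFactor.comap π) (X.measurableSpace.comap π) X'.maxInvFactor X'.μ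

/-- A pair of actions is magic if `A(X | I₂, T₁) = L²(I₁ ∨ I₂)`. The first and the second action
have the indices `0` and `1`. -/
def IsMagic (X : MPS.{u} G 2) : Prop :=
  relAlmostPeriodic (X.inv 1) X.μ (X.T 0) (X.T_measurePreserving 0) =
    lpMeas ℂ ℂ (X.inv 0 ⊔ X.inv 1) 2 X.μ

end MPS

end CommutingActions

end

/-!
One inclusion needs no satedness. For a set `A` invariant under the first action and `B` invariant
under the second, the indicator of `A ∩ B` lies in the rank-one module `L^∞(I₂) · 1_A`, which is
invariant under the first action. The sets `A ∩ B` form a π-system generating `I₁ ∨ I₂`, whence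
`L²(I₁ ∨ I₂) ⊆ A(X | I₂, T₁)` (`lpMeas_le_relAlmostPeriodic`).

For the other inclusion, let `f` be orthogonal to `L²(I₁ ∨ I₂)` and `m` a member of a finite rank
invariant module `M`; the claim is `⟪m, f⟫ = 0` (`inner_eq_zero_of_isInvSated`). Disintegrate `μ`
over `I₂` into conditional measures `κ b` and let `X'` be the relatively independent square, that
is, `X × X` with the measure `∫ κ b × κ b` (`relProd`). The first action acts on it diagonally, and
the second as `T₂ × id`; the first coordinate makes it an extension of `X` (`relSquare`).

A measurable fibrewise Gram–Schmidt process (`exists_gramSchmidt`) replaces the generators of `M` by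
functions `e i` that are on almost every fibre pairwise orthogonal and of norm one or zero. The
kernel `K (x, y) = ∑ i, e i x * conj (e i y)` of the fibrewise orthogonal projection onto the module
is invariant under the diagonal action (`projKernel_comp_ae_eq`): by invariance of the module and
Parseval's identity, `K` and its translate `K'` satisfy `⟪K', K⟫ = ‖K‖² = ‖K'‖²`. As `m y` does not
depend on the first coordinate, `K (x, y) * m y` is measurable for the σ-algebra generated by the
invariant sets of `X'`. Satedness makes it orthogonal to `f x`, and by the reproducing property of
the projection this inner product is `⟪m, f⟫`.

The space `X` is second countable and Hausdorff, but need not be standard Borel. Conditional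
measures exist because the regular measure `μ` is carried by a σ-compact set
(`exists_isDisintegration`), and the measure on `X'` is again regular because it is tight
(`regular_of_tight`).
-/

noncomputable section

open ProbabilityTheory
open scoped ENNReal ComplexConjugate

namespace CommutingActions

/-! ### Regular measures on second countable Hausdorff spaces -/

/-- Compact subsets of a second countable Hausdorff space are metrizable, so finite Borel measures on
them are inner regular; tightness extends this to the whole space. -/
theorem regular_of_tight {Y : Type*} [TopologicalSpace Y] [T2Space Y] [SecondCountableTopology Y]
    [MeasurableSpace Y] [BorelSpace Y] (ν : Measure Y) [IsFiniteMeasure ν]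
    (h : ∀ ε : ℝ≥0∞, ε ≠ 0 → ∃ K : Set Y, IsCompact K ∧ ν Kᶜ < ε) : ν.Regular := by
  suffices hI : ν.InnerRegular by infer_instance
  refine ⟨fun A hA r hr => ?_⟩
  obtain ⟨K, hK, hKε⟩ := h (ν A - r) (tsub_pos_of_lt hr).ne'
  have hAK : r < ν (A ∩ K) := by
    have h1 : ν A ≤ ν (A ∩ K) + ν Kᶜ := by
      rw [← measure_inter_add_sdiff A hK.measurableSet]
      gcongr
      exact fun x hx => hx.2
    by_contra! h2
    have h3 : ν A < ν A := calc
      ν A ≤ ν (A ∩ K) + ν Kᶜ := h1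
      _ < r + (ν A - r) :=
        ENNReal.add_lt_add_of_le_of_lt (measure_ne_top ν _) h2 hKε
      _ = ν A := add_tsub_cancel_of_le hr.le
    exact lt_irrefl _ h3
  have : CompactSpace K := isCompact_iff_compactSpace.1 hK
  have := TopologicalSpace.metrizableSpace_of_t3_secondCountable K
  have hemb := MeasurableEmbedding.subtype_coe hK.measurableSet
  have hc : (ν.comap ((↑) : K → Y)) ((↑) ⁻¹' A) = ν (A ∩ K) := by
    rw [hemb.comap_apply, Subtype.image_preimage_coe, Set.inter_comm]
  have hfin : IsFiniteMeasure (ν.comap ((↑) : K → Y)) := by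
    refine ⟨?_⟩
    rw [hemb.comap_apply]
    exact measure_lt_top _ _
  obtain ⟨F, hFA, hF, hrF⟩ := (hA.preimage measurable_subtype_coe).exists_lt_isClosed_of_ne_top
    (measure_ne_top (ν.comap ((↑) : K → Y)) _) (hc ▸ hAK)
  refine ⟨(↑) '' F, ?_, hF.isCompact.image continuous_subtype_val, ?_⟩
  · rintro _ ⟨x, hx, rfl⟩
    exact hFA hx
  · rwa [hemb.comap_apply] at hrF

theorem exists_isCompact_compl_lt {Y : Type*} [TopologicalSpace Y] [T2Space Y]
    [MeasurableSpace Y] [BorelSpace Y] (μ : Measure Y) [IsFiniteMeasure μ] [μ.Regular]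
    {ε : ℝ≥0∞} (hε : ε ≠ 0) : ∃ K : Set Y, IsCompact K ∧ μ Kᶜ < ε := by
  obtain ⟨K, -, hK, h⟩ :=
    MeasurableSet.univ.exists_isCompact_sdiff_lt (measure_ne_top μ Set.univ) hε
  exact ⟨K, hK, by rwa [Set.compl_eq_univ_sdiff]⟩

/-- Up to a null set, a second countable Hausdorff space with a regular finite measure embeds into
the Cantor space with a measurable inverse. -/
theorem exists_measurable_ae_leftInverse {Y : Type*} [TopologicalSpace Y] [T2Space Y]
    [SecondCountableTopology Y] [MeasurableSpace Y] [BorelSpace Y] [Nonempty Y] (μ : Measure Y)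
    [IsFiniteMeasure μ] [μ.Regular] :
    ∃ (e : Y → ℕ → Bool) (r : (ℕ → Bool) → Y), Measurable e ∧ Measurable r ∧
      ∀ᵐ x ∂μ, r (e x) = x := by
  have hK : ∀ n : ℕ, ∃ K : Set Y, IsCompact K ∧ μ Kᶜ < (n + 1 : ℝ≥0∞)⁻¹ := fun n =>
    exists_isCompact_compl_lt μ (by simp)
  choose K hK hKμ using hK
  obtain ⟨s, ⟨E⟩⟩ := MeasurableSpace.measurableEquiv_nat_bool_of_countablyGenerated Y
  let e : Y → ℕ → Bool := fun x => E x
  have he : Measurable e := measurable_subtype_coe.comp E.measurable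
  have he_inj : Function.Injective e := Subtype.val_injective.comp E.injective
  -- Each compact set is Polish, so its image is measurable although the range of `e` need not be.
  have hD : ∀ n, MeasurableSet (e '' K n) := fun n => by
    have : CompactSpace (K n) := isCompact_iff_compactSpace.1 (hK n)
    have := TopologicalSpace.metrizableSpace_of_t3_secondCountable (K n)
    let _ := TopologicalSpace.metrizableSpaceMetric (K n)
    have h := ((he.comp measurable_subtype_coe).measurableEmbedding
      (he_inj.comp (Subtype.val_injective (p := (· ∈ K n))))).measurableSet_range
    rwa [Set.range_comp, Subtype.range_coe] at h
  have hDs : ∀ d ∈ ⋃ n, e '' K n, d ∈ s := by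
    rintro d hd
    obtain ⟨n, x, -, rfl⟩ := Set.mem_iUnion.1 hd
    exact (E x).2
  let g : (⋃ n, e '' K n : Set (ℕ → Bool)) → Y := fun d => E.symm ⟨d, hDs d d.2⟩
  have hg : Measurable g := E.symm.measurable.comp (measurable_subtype_coe.subtype_mk)
  obtain ⟨r, hr, hrg⟩ := (MeasurableEmbedding.subtype_coe
    (MeasurableSet.iUnion hD)).exists_measurable_extend hg fun _ => inferInstance
  refine ⟨e, r, he, hr, ?_⟩
  have h0 : μ (⋃ n, K n)ᶜ = 0 := by
    refine le_antisymm (ENNReal.le_of_forall_pos_le_add fun ε hε _ => ?_) bot_le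
    obtain ⟨n, hn⟩ := ENNReal.exists_inv_nat_lt (a := ε) (by simpa using hε.ne')
    calc μ (⋃ n, K n)ᶜ ≤ μ (K n)ᶜ :=
          measure_mono (Set.compl_subset_compl.2 (Set.subset_iUnion K n))
      _ ≤ (n + 1 : ℝ≥0∞)⁻¹ := (hKμ n).le
      _ ≤ (n : ℝ≥0∞)⁻¹ := ENNReal.inv_le_inv.2 le_self_add
      _ ≤ 0 + ε := by simpa using hn.le
  filter_upwards [compl_mem_ae_iff.2 h0] with x hx
  rw [compl_compl] at hx
  obtain ⟨n, hn⟩ := Set.mem_iUnion.1 hx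
  have h1 := congrFun hrg ⟨e x, Set.mem_iUnion.2 ⟨n, x, hn, rfl⟩⟩
  simpa [g, e] using h1

/-! ### Disintegrations -/

theorem integral_comp_measure {α β : Type*} [MeasurableSpace α] [MeasurableSpace β]
    {μ : Measure α} [SFinite μ] {κ : Kernel α β} [IsSFiniteKernel κ] {f : β → ℂ}
    (hf : Integrable f (κ ∘ₘ μ)) : ∫ x, f x ∂(κ ∘ₘ μ) = ∫ a, ∫ x, f x ∂κ a ∂μ := by
  rw [Measure.comp_eq_comp_const_apply] at hf ⊢
  rw [Kernel.integral_comp hf, Kernel.const_apply]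

/-- `κ` disintegrates `μ` over the measurable map `p`: the measure `κ b` is the conditional law of
`x` given `p x = b`. -/
structure IsDisintegration {Y β : Type*} [MeasurableSpace Y] [MeasurableSpace β] (μ : Measure Y)
    (p : Y → β) (κ : Kernel β Y) : Prop where
  measurable : Measurable p
  compProd_eq : μ.map p ⊗ₘ κ = μ.map fun x => (p x, x)

/-- The space `Y` need not be standard Borel, so the conditional law is taken after transport to
the Cantor space and then pulled back. -/
theorem exists_isDisintegration {Y β : Type*} [TopologicalSpace Y] [T2Space Y]
    [SecondCountableTopology Y] [MeasurableSpace Y] [BorelSpace Y] [MeasurableSpace β]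
    (μ : Measure Y) [IsProbabilityMeasure μ] [μ.Regular] {p : Y → β} (hp : Measurable p) :
    ∃ κ : Kernel β Y, IsMarkovKernel κ ∧ IsDisintegration μ p κ := by
  have : Nonempty Y := nonempty_of_isProbabilityMeasure μ
  obtain ⟨e, r, he, hr, hre⟩ := exists_measurable_ae_leftInverse μ
  refine ⟨(condDistrib e p μ).map r, Kernel.IsMarkovKernel.map _ hr, hp, ?_⟩
  rw [Measure.compProd_map hr, compProd_map_condDistrib he.aemeasurable,
    Measure.map_map (by fun_prop) (by fun_prop)]
  refine Measure.map_congr ?_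
  filter_upwards [hre] with x hx
  simp [hx]

namespace IsDisintegration

variable {Y β : Type*} [MeasurableSpace Y] [MeasurableSpace β] {μ : Measure Y}
  [IsProbabilityMeasure μ] {p : Y → β} {κ : Kernel β Y} [IsMarkovKernel κ]

omit [IsMarkovKernel κ] in
theorem isProbabilityMeasure_map (h : IsDisintegration μ p κ) :
    IsProbabilityMeasure (μ.map p) :=
  Measure.isProbabilityMeasure_map h.measurable.aemeasurable

theorem comp_eq (h : IsDisintegration μ p κ) : κ ∘ₘ μ.map p = μ := by
  have hp := h.measurable
  rw [← Measure.snd_compProd, h.compProd_eq, Measure.snd, Measure.map_map (by fun_prop)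
    (by fun_prop)]
  exact Measure.map_id

theorem ae_ae (h : IsDisintegration μ p κ) {q : Y → Prop} (hq : ∀ᵐ x ∂μ, q x) :
    ∀ᵐ b ∂μ.map p, ∀ᵐ x ∂κ b, q x := by
  rw [← h.comp_eq] at hq
  exact Measure.ae_ae_of_ae_comp hq

/-- A function of the base point is constant on almost every fibre. -/
theorem ae_ae_base_eq (h : IsDisintegration μ p κ) {a : β → ℂ} (ha : Measurable a) :
    ∀ᵐ b ∂μ.map p, ∀ᵐ x ∂κ b, a (p x) = a b := by
  have hp := h.measurable
  have hm : MeasurableSet {z : β × Y | a (p z.2) = a z.1} :=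
    measurableSet_eq_fun (by fun_prop) (by fun_prop)
  have h1 : ∀ᵐ z ∂(μ.map p ⊗ₘ κ), a (p z.2) = a z.1 := by
    rw [h.compProd_eq, ae_map_iff (by fun_prop) hm]
    simp
  exact Measure.ae_ae_of_ae_compProd h1

theorem lintegral_eq (h : IsDisintegration μ p κ) {f : Y → ℝ≥0∞} (hf : Measurable f) :
    ∫⁻ x, f x ∂μ = ∫⁻ b, ∫⁻ x, f x ∂κ b ∂μ.map p := by
  conv_lhs => rw [← h.comp_eq]
  exact Measure.lintegral_bind κ.aemeasurable hf.aemeasurable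

theorem integral_eq (h : IsDisintegration μ p κ) {f : Y → ℂ} (hf : Integrable f μ) :
    ∫ x, f x ∂μ = ∫ b, ∫ x, f x ∂κ b ∂μ.map p := by
  conv_lhs => rw [← h.comp_eq]
  exact integral_comp_measure (by rwa [h.comp_eq])

theorem ae_memLp (h : IsDisintegration μ p κ) {f : Y → ℂ} (hf : MemLp f 2 μ) :
    ∀ᵐ b ∂μ.map p, MemLp f 2 (κ b) := by
  have h1 : Integrable (fun x => ‖f x‖ ^ 2) (κ ∘ₘ μ.map p) := by
    rw [h.comp_eq]
    exact hf.integrable_norm_pow (by norm_num)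
  have h2 := h.ae_ae hf.1.ae_eq_mk
  filter_upwards [Measure.ae_integrable_of_integrable_comp h1, h2] with b hb hb2
  exact (memLp_two_iff_integrable_sq_norm
    (hf.1.stronglyMeasurable_mk.aestronglyMeasurable.congr
      (Filter.EventuallyEq.symm hb2))).2 hb

end IsDisintegration

/-! ### Relatively independent self-joinings -/

/-- The product of the conditional laws `κ b` with themselves, integrated over the base. If `κ`
disintegrates `μ` over `p`, this is the relatively independent self-joining of `μ` over `p`. -/
def relProd {Y β : Type*} [MeasurableSpace Y] [MeasurableSpace β] (ρ : Measure β)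
    (κ : Kernel β Y) : Measure (Y × Y) :=
  (κ ×ₖ κ) ∘ₘ ρ

namespace IsDisintegration

variable {Y β : Type*} [MeasurableSpace Y] [MeasurableSpace β] {μ : Measure Y}
  [IsProbabilityMeasure μ] {p : Y → β} {κ : Kernel β Y} [IsMarkovKernel κ]

theorem isProbabilityMeasure_relProd (h : IsDisintegration μ p κ) :
    IsProbabilityMeasure (relProd (μ.map p) κ) := by
  have := h.isProbabilityMeasure_map
  unfold relProd
  infer_instance

theorem relProd_apply (A B : Set Y) (hA : MeasurableSet A) (hB : MeasurableSet B) (ρ : Measure β) :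
    relProd ρ κ (A ×ˢ B) = ∫⁻ b, κ b A * κ b B ∂ρ := by
  rw [relProd, Measure.bind_apply (hA.prod hB) (Kernel.aemeasurable _)]
  simp [Kernel.prod_apply_prod]

theorem map_fst_relProd (h : IsDisintegration μ p κ) : (relProd (μ.map p) κ).map Prod.fst = μ := by
  rw [relProd, Measure.map_comp _ _ measurable_fst, ← Kernel.fst_eq, Kernel.fst_prod, h.comp_eq]

theorem map_snd_relProd (h : IsDisintegration μ p κ) : (relProd (μ.map p) κ).map Prod.snd = μ := by
  rw [relProd, Measure.map_comp _ _ measurable_snd, ← Kernel.snd_eq, Kernel.snd_prod, h.comp_eq]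

theorem setLIntegral_eq (h : IsDisintegration μ p κ) {D : Set β} (hD : MeasurableSet D) {A : Set Y}
    (hA : MeasurableSet A) : ∫⁻ b in D, κ b A ∂μ.map p = μ (p ⁻¹' D ∩ A) := by
  have hp := h.measurable
  rw [← Measure.compProd_apply_prod hD hA, h.compProd_eq,
    Measure.map_apply (by fun_prop) (hD.prod hA)]
  rfl

omit [IsProbabilityMeasure μ] [IsMarkovKernel κ] in
theorem measurePreserving_base (h : IsDisintegration μ p κ) {T : Y → Y}
    (hT : MeasurePreserving T μ μ) (S : β ≃ᵐ β)
    (hS : ∀ D, MeasurableSet D → p ⁻¹' (S ⁻¹' D) =ᵐ[μ] T ⁻¹' (p ⁻¹' D)) :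
    MeasurePreserving S (μ.map p) (μ.map p) := by
  have hp := h.measurable
  refine ⟨S.measurable, Measure.ext fun D hD => ?_⟩
  rw [Measure.map_apply S.measurable hD, Measure.map_apply hp (S.measurable hD),
    Measure.map_apply hp hD, measure_congr (hS D hD),
    hT.measure_preimage (hp hD).nullMeasurableSet]

/-- Equivariance of conditional laws: `κ (S b)` is the image of `κ b` under a transformation `T`
that acts on the base as `S`. -/
theorem ae_preimage_eq (h : IsDisintegration μ p κ) {T : Y → Y}
    (hT : MeasurePreserving T μ μ) (S : β ≃ᵐ β)
    (hS : ∀ D, MeasurableSet D → p ⁻¹' (S ⁻¹' D) =ᵐ[μ] T ⁻¹' (p ⁻¹' D)) {A : Set Y}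
    (hA : MeasurableSet A) : (fun b => κ b (T ⁻¹' A)) =ᵐ[μ.map p] fun b => κ (S b) A := by
  have hp := h.measurable
  have := h.isProbabilityMeasure_map
  refine ae_eq_of_forall_setLIntegral_eq_of_sigmaFinite (κ.measurable_coe (hT.measurable hA))
    ((κ.measurable_coe hA).comp S.measurable) fun D hD _ => ?_
  have hD' : D = S ⁻¹' (S.symm ⁻¹' D) := by
    ext x
    simp
  have hDm : MeasurableSet (S.symm ⁻¹' D) := S.symm.measurable hD
  rw [h.setLIntegral_eq hD (hT.measurable hA), hD',
    (h.measurePreserving_base hT S hS).setLIntegral_comp_preimage hDm (κ.measurable_coe hA),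
    h.setLIntegral_eq hDm hA,
    measure_congr ((hS _ hDm).inter (ae_eq_refl (T ⁻¹' A))), ← Set.preimage_inter,
    hT.measure_preimage ((hp hDm).inter hA).nullMeasurableSet]

/-- The relatively independent self-joining is invariant under `T × T'` if `T` and `T'` act in the
same way on the base. -/
theorem measurePreserving_prodMap (h : IsDisintegration μ p κ) {T T' : Y → Y}
    (hT : MeasurePreserving T μ μ) (hT' : MeasurePreserving T' μ μ) (S : β ≃ᵐ β)
    (hS : ∀ D, MeasurableSet D → p ⁻¹' (S ⁻¹' D) =ᵐ[μ] T ⁻¹' (p ⁻¹' D))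
    (hS' : ∀ D, MeasurableSet D → p ⁻¹' (S ⁻¹' D) =ᵐ[μ] T' ⁻¹' (p ⁻¹' D)) :
    MeasurePreserving (Prod.map T T') (relProd (μ.map p) κ) (relProd (μ.map p) κ) := by
  have := h.isProbabilityMeasure_relProd
  have hm : Measurable (Prod.map T T') := hT.measurable.prodMap hT'.measurable
  refine ⟨hm, ?_⟩
  have : IsFiniteMeasure ((relProd (μ.map p) κ).map (Prod.map T T')) :=
    Measure.isFiniteMeasure_map _ _
  refine Measure.ext_prod fun {A B} hA hB => ?_
  rw [Measure.map_apply hm (hA.prod hB), Set.preimage_prod_map_prod,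
    relProd_apply _ _ (hT.measurable hA) (hT'.measurable hB), relProd_apply _ _ hA hB]
  refine Eq.trans ?_ ((h.measurePreserving_base hT S hS).lintegral_comp
    ((κ.measurable_coe hA).mul (κ.measurable_coe hB)))
  refine lintegral_congr_ae ?_
  filter_upwards [h.ae_preimage_eq hT S hS hA, h.ae_preimage_eq hT' S hS' hB] with b h1 h2
  rw [h1, h2]

theorem regular_relProd [TopologicalSpace Y] [T2Space Y] [SecondCountableTopology Y]
    [BorelSpace Y] [μ.Regular] (h : IsDisintegration μ p κ) :
    (relProd (μ.map p) κ).Regular := by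
  have := h.isProbabilityMeasure_relProd
  refine regular_of_tight _ fun ε hε => ?_
  obtain ⟨K, hK, hKε⟩ := exists_isCompact_compl_lt μ (ENNReal.half_pos hε).ne'
  refine ⟨K ×ˢ K, hK.prod hK, ?_⟩
  have h1 : relProd (μ.map p) κ (Prod.fst ⁻¹' Kᶜ) = μ Kᶜ := by
    rw [← Measure.map_apply measurable_fst hK.measurableSet.compl, h.map_fst_relProd]
  have h2 : relProd (μ.map p) κ (Prod.snd ⁻¹' Kᶜ) = μ Kᶜ := by
    rw [← Measure.map_apply measurable_snd hK.measurableSet.compl, h.map_snd_relProd]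
  calc relProd (μ.map p) κ (K ×ˢ K)ᶜ
      ≤ relProd (μ.map p) κ (Prod.fst ⁻¹' Kᶜ ∪ Prod.snd ⁻¹' Kᶜ) := by
        refine measure_mono fun z hz => ?_
        simp only [Set.mem_compl_iff, Set.mem_prod, Set.mem_union, Set.mem_preimage] at hz ⊢
        tauto
    _ ≤ μ Kᶜ + μ Kᶜ := (measure_union_le _ _).trans (by rw [h1, h2])
    _ < ε / 2 + ε / 2 := ENNReal.add_lt_add hKε hKε
    _ = ε := ENNReal.add_halves ε

theorem integral_relProd (h : IsDisintegration μ p κ) {F : Y × Y → ℂ}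
    (hF : Integrable F (relProd (μ.map p) κ)) :
    ∫ z, F z ∂relProd (μ.map p) κ = ∫ b, ∫ z, F z ∂(κ b).prod (κ b) ∂μ.map p := by
  have := h.isProbabilityMeasure_map
  rw [relProd, integral_comp_measure hF]
  simp [Kernel.prod_apply]

end IsDisintegration

/-! ### Partially orthonormal families -/

section Fibre

variable {Y : Type*} [MeasurableSpace Y] {ρ : Measure Y} {ι : Type*}

/-- A family in `L²(ρ)` of pairwise orthogonal functions, each of which has norm one or vanishes. -/
structure IsPartialOrthonormal (ρ : Measure Y) (e : ι → Y → ℂ) : Prop where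
  memLp : ∀ i, MemLp (e i) 2 ρ
  orthogonal : ∀ i j, i ≠ j → ∫ x, conj (e i x) * e j x ∂ρ = 0
  norm_or_zero : ∀ i, ∫ x, conj (e i x) * e i x ∂ρ = 1 ∨ e i =ᵐ[ρ] 0

theorem _root_.MeasureTheory.MemLp.conj_mul_integrable {f g : Y → ℂ} (hf : MemLp f 2 ρ)
    (hg : MemLp g 2 ρ) : Integrable (fun x => conj (f x) * g x) ρ :=
  hf.star.integrable_mul hg

theorem conj_integral_conj_mul (f g : Y → ℂ) :
    conj (∫ x, conj (f x) * g x ∂ρ) = ∫ x, conj (g x) * f x ∂ρ := by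
  rw [← integral_conj]
  simp [mul_comm]

namespace IsPartialOrthonormal

variable [Fintype ι] {e : ι → Y → ℂ}

theorem coeff_mul (he : IsPartialOrthonormal ρ e) {h : Y → ℂ} {c : ι → ℂ}
    (hc : h =ᵐ[ρ] fun x => ∑ i, c i * e i x) {g : Y → ℂ} (j : ι) :
    (∫ x, conj (h x) * e j x ∂ρ) * ∫ x, conj (e j x) * g x ∂ρ
      = conj (c j) * ∫ x, conj (e j x) * g x ∂ρ := by
  rcases he.norm_or_zero j with h1 | h0
  · congr 1
    have h2 : ∫ x, conj (h x) * e j x ∂ρ = ∫ x, ∑ i, conj (c i) * (conj (e i x) * e j x) ∂ρ := by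
      refine integral_congr_ae ?_
      filter_upwards [hc] with x hx
      rw [hx, map_sum, Finset.sum_mul]
      exact Finset.sum_congr rfl fun i _ => by rw [map_mul]; ring
    rw [h2, integral_finsetSum _ fun i _ =>
      ((he.memLp i).conj_mul_integrable (he.memLp j)).const_mul _]
    simp_rw [integral_const_mul]
    rw [Finset.sum_eq_single j (fun i _ hij => by rw [he.orthogonal i j hij, mul_zero]) (by simp),
      h1, mul_one]
  · have h2 : ∫ x, conj (e j x) * g x ∂ρ = 0 := by
      rw [← integral_zero Y ℂ]
      refine integral_congr_ae ?_
      filter_upwards [h0] with x hx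
      simp [hx]
    rw [h2, mul_zero, mul_zero]

/-- Parseval's identity for a function in the span of a partially orthonormal family. -/
theorem parseval (he : IsPartialOrthonormal ρ e) {h g : Y → ℂ} {c : ι → ℂ}
    (hc : h =ᵐ[ρ] fun x => ∑ i, c i * e i x) (hg : MemLp g 2 ρ) :
    ∫ x, conj (h x) * g x ∂ρ
      = ∑ i, (∫ x, conj (h x) * e i x ∂ρ) * ∫ x, conj (e i x) * g x ∂ρ := by
  have h2 : ∫ x, conj (h x) * g x ∂ρ = ∫ x, ∑ i, conj (c i) * (conj (e i x) * g x) ∂ρ := by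
    refine integral_congr_ae ?_
    filter_upwards [hc] with x hx
    rw [hx, map_sum, Finset.sum_mul]
    exact Finset.sum_congr rfl fun i _ => by rw [map_mul]; ring
  rw [h2, integral_finsetSum _ fun i _ => ((he.memLp i).conj_mul_integrable hg).const_mul _]
  exact Finset.sum_congr rfl fun i _ => by rw [he.coeff_mul hc, integral_const_mul]

end IsPartialOrthonormal

/-- The kernel `∑ i, e i ⊗ conj (e i)`. For a partially orthonormal family it is the integral kernel
of the orthogonal projection onto the span. -/
def projKernel [Fintype ι] (e : ι → Y → ℂ) (z : Y × Y) : ℂ :=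
  ∑ i, e i z.1 * conj (e i z.2)

variable [Fintype ι] {e : ι → Y → ℂ} [SFinite ρ]

theorem IsPartialOrthonormal.integral_conj_projKernel_mul (he : IsPartialOrthonormal ρ e)
    {f : ι → Y → ℂ} (hf : ∀ i, MemLp (f i) 2 ρ)
    (hc : ∀ i, ∃ c : ι → ℂ, f i =ᵐ[ρ] fun x => ∑ j, c j * e j x) :
    ∫ z, conj (projKernel f z) * projKernel e z ∂ρ.prod ρ
      = ∑ i, ∫ x, conj (f i x) * f i x ∂ρ := by
  have h1 : ∀ z, conj (projKernel f z) * projKernel e z =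
      ∑ i, ∑ j, (conj (f i z.1) * e j z.1) * (conj (e j z.2) * f i z.2) := by
    intro z
    simp only [projKernel, map_sum, map_mul, Complex.conj_conj, Finset.sum_mul_sum]
    exact Finset.sum_congr rfl fun i _ => Finset.sum_congr rfl fun j _ => by ring
  have hi : ∀ i j, Integrable (fun z : Y × Y =>
      (conj (f i z.1) * e j z.1) * (conj (e j z.2) * f i z.2)) (ρ.prod ρ) := fun i j =>
    ((hf i).conj_mul_integrable (he.memLp j)).mul_prod ((he.memLp j).conj_mul_integrable (hf i))
  simp_rw [h1]
  rw [integral_finsetSum _ fun i _ => integrable_finsetSum _ fun j _ => hi i j]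
  refine Finset.sum_congr rfl fun i _ => ?_
  rw [integral_finsetSum _ fun j _ => hi i j]
  obtain ⟨c, hc⟩ := hc i
  rw [he.parseval hc (hf i)]
  exact Finset.sum_congr rfl fun j _ => integral_prod_mul
    (fun x => conj (f i x) * e j x) (fun x => conj (e j x) * f i x)

theorem IsPartialOrthonormal.integral_conj_projKernel_mul_mul (he : IsPartialOrthonormal ρ e)
    {m f : Y → ℂ} (hm : MemLp m 2 ρ) (hf : MemLp f 2 ρ)
    (hc : ∃ c : ι → ℂ, m =ᵐ[ρ] fun x => ∑ j, c j * e j x) :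
    ∫ z, conj (projKernel e z * m z.2) * f z.1 ∂ρ.prod ρ = ∫ x, conj (m x) * f x ∂ρ := by
  have h1 : ∀ z : Y × Y, conj (projKernel e z * m z.2) * f z.1 =
      ∑ j, (conj (e j z.1) * f z.1) * (conj (m z.2) * e j z.2) := by
    intro z
    simp only [projKernel, map_sum, map_mul, Complex.conj_conj, Finset.sum_mul]
    exact Finset.sum_congr rfl fun j _ => by ring
  have hi : ∀ j, Integrable (fun z : Y × Y =>
      (conj (e j z.1) * f z.1) * (conj (m z.2) * e j z.2)) (ρ.prod ρ) := fun j =>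
    ((he.memLp j).conj_mul_integrable hf).mul_prod (hm.conj_mul_integrable (he.memLp j))
  simp_rw [h1]
  rw [integral_finsetSum _ fun j _ => hi j]
  obtain ⟨c, hc⟩ := hc
  rw [he.parseval hc hf]
  refine Finset.sum_congr rfl fun j _ => ?_
  rw [integral_prod_mul (fun x => conj (e j x) * f x) (fun x => conj (m x) * e j x), mul_comm]

end Fibre

section Fibre

variable {Y : Type*} [MeasurableSpace Y] {ρ : Measure Y} {ι : Type*} {e : ι → Y → ℂ}

theorem conj_mul_self_eq (z : ℂ) : conj z * z = ((‖z‖ ^ 2 : ℝ) : ℂ) := by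
  rw [← Complex.normSq_eq_conj_mul_self, Complex.normSq_eq_norm_sq]

/-- If `e a` already vanishes this adds a function to the family; otherwise it replaces one. -/
theorem IsPartialOrthonormal.update [DecidableEq ι] (he : IsPartialOrthonormal ρ e) {a : ι}
    {w : Y → ℂ} (hw : MemLp w 2 ρ) (horth : ∀ i, ∫ x, conj (e i x) * w x ∂ρ = 0)
    (hnorm : ∫ x, conj (w x) * w x ∂ρ = 1 ∨ w =ᵐ[ρ] 0) :
    IsPartialOrthonormal ρ (Function.update e a w) where
  memLp i := by
    by_cases h : i = a
    · subst h
      simpa using hw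
    · simpa [h] using he.memLp i
  orthogonal i j hij := by
    by_cases h : i = a
    · subst h
      rw [Function.update_self, Function.update_of_ne hij.symm, ← conj_integral_conj_mul, horth,
        map_zero]
    · by_cases h' : j = a
      · subst h'
        rw [Function.update_self, Function.update_of_ne hij, horth]
      · rw [Function.update_of_ne h, Function.update_of_ne h', he.orthogonal i j hij]
  norm_or_zero i := by
    by_cases h : i = a
    · subst h
      simpa using hnorm
    · simpa [h] using he.norm_or_zero i

theorem IsPartialOrthonormal.memLp_residual [Fintype ι] (he : IsPartialOrthonormal ρ e)
    {φ : Y → ℂ} (hφ : MemLp φ 2 ρ) (a : ι → ℂ) : MemLp (fun x => φ x - ∑ i, a i * e i x) 2 ρ :=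
  hφ.sub (memLp_finsetSum _ fun i _ => (he.memLp i).const_mul (a i))

theorem IsPartialOrthonormal.integral_conj_mul_residual [Fintype ι] (he : IsPartialOrthonormal ρ e)
    {φ : Y → ℂ} (hφ : MemLp φ 2 ρ) (j : ι) :
    ∫ x, conj (e j x) * (φ x - ∑ i, (∫ y, conj (e i y) * φ y ∂ρ) * e i x) ∂ρ = 0 := by
  obtain ⟨a, ha⟩ : ∃ a : ι → ℂ, ∀ i, a i = ∫ y, conj (e i y) * φ y ∂ρ := ⟨_, fun _ => rfl⟩
  simp_rw [← ha]
  rcases he.norm_or_zero j with h1 | h0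
  · simp_rw [mul_sub, Finset.mul_sum]
    rw [integral_sub ((he.memLp j).conj_mul_integrable hφ)]
    · rw [integral_finsetSum, Finset.sum_eq_single j]
      · simp_rw [mul_left_comm _ (a j), integral_const_mul]
        rw [h1, mul_one, ← ha, sub_self]
      · intro i _ hij
        simp_rw [mul_left_comm _ (a i), integral_const_mul]
        rw [he.orthogonal j i hij.symm, mul_zero]
      · simp
      · intro i _
        simp_rw [mul_left_comm _ (a i)]
        exact ((he.memLp j).conj_mul_integrable (he.memLp i)).const_mul _
    · refine integrable_finsetSum _ fun i _ => ?_
      simp_rw [mul_left_comm _ (a i)]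
      exact ((he.memLp j).conj_mul_integrable (he.memLp i)).const_mul _
  · rw [← integral_zero Y ℂ]
    refine integral_congr_ae ?_
    filter_upwards [h0] with x hx
    simp [hx]

theorem ae_eq_zero_of_integral_norm_sq_eq_zero {u : Y → ℂ} (hu : MemLp u 2 ρ)
    (h : ∫ x, ‖u x‖ ^ 2 ∂ρ = 0) : u =ᵐ[ρ] 0 := by
  have h1 := (integral_eq_zero_iff_of_nonneg (fun x => by positivity)
    (hu.integrable_norm_pow (by norm_num))).1 h
  filter_upwards [h1] with x hx
  simpa using hx

theorem integral_conj_mul_self (u : Y → ℂ) :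
    ∫ x, conj (u x) * u x ∂ρ = ((∫ x, ‖u x‖ ^ 2 ∂ρ : ℝ) : ℂ) := by
  simp_rw [conj_mul_self_eq]
  exact integral_ofReal

/-- Normalisation; a function of norm zero is normalised to zero, since `0⁻¹ = 0`. -/
theorem integral_normalize_or_zero {u : Y → ℂ} (hu : MemLp u 2 ρ) {s : ℝ}
    (hs : s = Real.sqrt (∫ x, ‖u x‖ ^ 2 ∂ρ)) :
    (∫ x, conj ((s : ℂ)⁻¹ * u x) * ((s : ℂ)⁻¹ * u x) ∂ρ = 1 ∨
      (fun x => (s : ℂ)⁻¹ * u x) =ᵐ[ρ] 0) ∧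
    u =ᵐ[ρ] fun x => (s : ℂ) * ((s : ℂ)⁻¹ * u x) := by
  have hN : 0 ≤ ∫ x, ‖u x‖ ^ 2 ∂ρ := integral_nonneg fun x => by positivity
  by_cases h0 : ∫ x, ‖u x‖ ^ 2 ∂ρ = 0
  · have hu0 := ae_eq_zero_of_integral_norm_sq_eq_zero hu h0
    refine ⟨Or.inr ?_, ?_⟩
    · filter_upwards [hu0] with x hx
      simp [hx]
    · filter_upwards [hu0] with x hx
      simp [hx]
  · have hs0 : (s : ℂ) ≠ 0 := by
      rw [hs, Complex.ofReal_ne_zero, Real.sqrt_ne_zero hN]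
      exact h0
    refine ⟨Or.inl ?_, Filter.Eventually.of_forall fun x => by field_simp⟩
    have h1 : ∀ x, conj ((s : ℂ)⁻¹ * u x) * ((s : ℂ)⁻¹ * u x)
        = (s : ℂ)⁻¹ ^ 2 * (conj (u x) * u x) := fun x => by
      rw [map_mul, map_inv₀, Complex.conj_ofReal]
      ring
    simp_rw [h1]
    have h2 : (s : ℂ) ^ 2 = ((∫ x, ‖u x‖ ^ 2 ∂ρ : ℝ) : ℂ) := by
      rw [← Complex.ofReal_pow, hs, Real.sq_sqrt hN]
    rw [integral_const_mul, integral_conj_mul_self, ← h2]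
    field_simp

end Fibre

/-! ### Fibrewise Gram–Schmidt process -/

section Span

variable {Y β : Type*} [MeasurableSpace Y] [MeasurableSpace β] {μ : Measure Y} {p : Y → β}
  {ι ι' : Type*} [Fintype ι] [Fintype ι'] {e : ι → Y → ℂ} {φ : ι' → Y → ℂ} {h h' : Y → ℂ}

/-- `h` is almost everywhere a combination of the functions `e i` with coefficients that are
measurable functions of the base point; no integrability of the coefficients is required. -/
def InRelSpan (μ : Measure Y) (p : Y → β) (e : ι → Y → ℂ) (h : Y → ℂ) : Prop :=
  ∃ c : ι → β → ℂ, (∀ i, Measurable (c i)) ∧ h =ᵐ[μ] fun x => ∑ i, c i (p x) * e i x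

theorem InRelSpan.self (i : ι) : InRelSpan μ p e (e i) := by
  classical
  refine ⟨fun j _ => if j = i then 1 else 0, fun j => measurable_const, ?_⟩
  simp

theorem InRelSpan.trans (hφ : ∀ j, InRelSpan μ p e (φ j)) (hh : InRelSpan μ p φ h) :
    InRelSpan μ p e h := by
  choose c hcm hc using hφ
  obtain ⟨d, hdm, hd⟩ := hh
  refine ⟨fun i b => ∑ j, d j b * c j i b, fun i => by fun_prop, ?_⟩
  filter_upwards [hd, ae_all_iff.2 hc] with x hx hcx
  rw [hx]
  simp_rw [hcx, Finset.mul_sum, Finset.sum_mul]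
  rw [Finset.sum_comm]
  exact Finset.sum_congr rfl fun i _ => Finset.sum_congr rfl fun j _ => by ring

theorem InRelSpan.sub (hh : InRelSpan μ p e h) (hh' : InRelSpan μ p e h') :
    InRelSpan μ p e fun x => h x - h' x := by
  obtain ⟨c, hcm, hc⟩ := hh
  obtain ⟨d, hdm, hd⟩ := hh'
  refine ⟨fun i b => c i b - d i b, fun i => by fun_prop, ?_⟩
  filter_upwards [hc, hd] with x hx hx'
  simp_rw [hx, hx', sub_mul, Finset.sum_sub_distrib]

theorem InRelSpan.base_mul (hh : InRelSpan μ p e h) {a : β → ℂ} (ha : Measurable a) :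
    InRelSpan μ p e fun x => a (p x) * h x := by
  obtain ⟨c, hcm, hc⟩ := hh
  refine ⟨fun i b => a b * c i b, fun i => by fun_prop, ?_⟩
  filter_upwards [hc] with x hx
  simp_rw [hx, Finset.mul_sum, mul_assoc]

theorem InRelSpan.comp (hh : InRelSpan μ p e h) {T : Y → Y} (hT : MeasurePreserving T μ μ)
    {S : β → β} (hS : Measurable S) (hTS : ∀ x, p (T x) = S (p x)) :
    InRelSpan μ p (fun i => e i ∘ T) (h ∘ T) := by
  obtain ⟨c, hcm, hc⟩ := hh
  refine ⟨fun i => c i ∘ S, fun i => (hcm i).comp hS, ?_⟩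
  filter_upwards [hT.quasiMeasurePreserving.ae_eq_comp hc] with x hx
  simpa [hTS] using hx

theorem InRelSpan.ae_fibre [IsProbabilityMeasure μ] {κ : Kernel β Y} [IsMarkovKernel κ]
    (hκ : IsDisintegration μ p κ) (hh : InRelSpan μ p e h) :
    ∀ᵐ b ∂μ.map p, ∃ c : ι → ℂ, h =ᵐ[κ b] fun x => ∑ i, c i * e i x := by
  obtain ⟨c, hcm, hc⟩ := hh
  filter_upwards [hκ.ae_ae hc, ae_all_iff.2 fun i => hκ.ae_ae_base_eq (hcm i)] with b h1 h2
  refine ⟨fun i => c i b, ?_⟩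
  filter_upwards [h1, ae_all_iff.2 h2] with x hx hx2
  rw [hx]
  exact Finset.sum_congr rfl fun i _ => by rw [hx2]

/-- Since `e a = 0`, replacing it does not shrink the span. -/
theorem InRelSpan.update [DecidableEq ι] (hh : InRelSpan μ p e h) {a : ι} (ha : e a = 0)
    (w : Y → ℂ) : InRelSpan μ p (Function.update e a w) h := by
  obtain ⟨c, hcm, hc⟩ := hh
  refine ⟨Function.update c a 0, fun i => ?_, ?_⟩
  · by_cases hi : i = a
    · subst hi
      rw [Function.update_self]
      exact measurable_const
    · simpa [hi] using hcm i
  · filter_upwards [hc] with x hx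
    rw [hx]
    refine Finset.sum_congr rfl fun i _ => ?_
    by_cases hi : i = a
    · subst hi
      simp [ha]
    · simp [hi]

variable [IsProbabilityMeasure μ] {κ : Kernel β Y} [IsMarkovKernel κ]

omit [IsMarkovKernel κ] in
theorem measurable_fibre_integral {f : Y → ℂ} (hf : Measurable f) :
    Measurable fun b => ∫ x, f x ∂κ b :=
  (hf.stronglyMeasurable.integral_kernel (κ := κ)).measurable

/-- One step of the fibrewise Gram–Schmidt process: `A i` are the fibrewise coordinates of `f`, and
`s` is the fibrewise norm of the residual. Where `s` vanishes, so does the residual, and `w = 0`. -/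
theorem exists_gramSchmidt_step (hκ : IsDisintegration μ p κ) (hem : ∀ i, Measurable (e i))
    (he : ∀ᵐ b ∂μ.map p, IsPartialOrthonormal (κ b) e) {f : Y → ℂ} (hfm : Measurable f)
    (hf : MemLp f 2 μ) :
    ∃ w : Y → ℂ, ∃ A : ι → β → ℂ, ∃ s : β → ℂ, Measurable w ∧ (∀ i, Measurable (A i)) ∧
      Measurable s ∧
      (∀ x, w x = (s (p x))⁻¹ * (f x - ∑ i, A i (p x) * e i x)) ∧
      (f =ᵐ[μ] fun x => (∑ i, A i (p x) * e i x) + s (p x) * w x) ∧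
      ∀ᵐ b ∂μ.map p, MemLp w 2 (κ b) ∧ (∀ i, ∫ x, conj (e i x) * w x ∂κ b = 0) ∧
        (∫ x, conj (w x) * w x ∂κ b = 1 ∨ w =ᵐ[κ b] 0) := by
  have hp := hκ.measurable
  let A : ι → β → ℂ := fun i b => ∫ x, conj (e i x) * f x ∂κ b
  have hA : ∀ i, Measurable (A i) := fun i =>
    measurable_fibre_integral ((Complex.continuous_conj.measurable.comp (hem i)).mul hfm)
  let u : Y → ℂ := fun x => f x - ∑ i, A i (p x) * e i x
  have hu : Measurable u := by fun_prop
  let t : β → ℝ := fun b => Real.sqrt (∫ x, ‖u x‖ ^ 2 ∂κ b)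
  have ht : Measurable t := by
    have : Measurable fun b => ∫ x, ‖u x‖ ^ 2 ∂κ b :=
      ((hu.norm.pow_const 2).stronglyMeasurable.integral_kernel (κ := κ)).measurable
    exact this.sqrt
  let s : β → ℂ := fun b => (t b : ℂ)
  have hs : Measurable s := Complex.measurable_ofReal.comp ht
  let w : Y → ℂ := fun x => (s (p x))⁻¹ * u x
  have hw : Measurable w := by fun_prop
  have key : ∀ᵐ b ∂μ.map p, (MemLp w 2 (κ b) ∧ (∀ i, ∫ x, conj (e i x) * w x ∂κ b = 0) ∧
        (∫ x, conj (w x) * w x ∂κ b = 1 ∨ w =ᵐ[κ b] 0)) ∧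
        u =ᵐ[κ b] fun x => s (p x) * w x := by
    filter_upwards [he, hκ.ae_memLp hf, ae_all_iff.2 fun i => hκ.ae_ae_base_eq (hA i),
      hκ.ae_ae_base_eq hs] with b hb hfb hAb hsb
    have hu_eq : u =ᵐ[κ b] fun x => f x - ∑ i, A i b * e i x := by
      filter_upwards [ae_all_iff.2 hAb] with x hx
      simp only [u, hx]
    have huL : MemLp u 2 (κ b) := (memLp_congr_ae hu_eq).2 (hb.memLp_residual hfb _)
    have hw_eq : w =ᵐ[κ b] fun x => (s b)⁻¹ * u x := by
      filter_upwards [hsb] with x hx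
      simp only [w, hx]
    obtain ⟨h1, h2⟩ := integral_normalize_or_zero huL (s := t b) rfl
    refine ⟨⟨(memLp_congr_ae hw_eq).2 (huL.const_mul _), fun i => ?_, ?_⟩, ?_⟩
    · have h3 : ∫ x, conj (e i x) * w x ∂κ b
          = ∫ x, (s b)⁻¹ * (conj (e i x) * (f x - ∑ i, A i b * e i x)) ∂κ b := by
        refine integral_congr_ae ?_
        filter_upwards [hw_eq, hu_eq] with x hx hx'
        rw [hx, hx']
        ring
      rw [h3, integral_const_mul, hb.integral_conj_mul_residual hfb i, mul_zero]
    · refine h1.imp (fun h => ?_) fun h => hw_eq.trans h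
      rw [← h]
      refine integral_congr_ae ?_
      filter_upwards [hw_eq] with x hx
      rw [hx]
    · filter_upwards [h2, hw_eq, hsb] with x hx hx' hx''
      rw [hx', hx'']
      exact hx
  refine ⟨w, A, s, hw, hA, hs, fun x => rfl, ?_, key.mono fun b hb => hb.1⟩
  have h1 : ∀ᵐ x ∂μ, u x = s (p x) * w x := by
    rw [← hκ.comp_eq]
    exact Measure.ae_comp_of_ae_ae (measurableSet_eq_fun hu (by fun_prop))
      (key.mono fun b hb => hb.2)
  filter_upwards [h1] with x hx
  rw [← hx]
  simp [u]

/-- A measurable Gram–Schmidt process on the fibres of `p`. The `φ i` may be linearly dependent on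
some fibres, which is why only partial orthonormality is obtained. -/
theorem exists_gramSchmidt (hκ : IsDisintegration μ p κ) {φ : ι → Y → ℂ}
    (hφm : ∀ i, Measurable (φ i)) (hφ : ∀ i, MemLp (φ i) 2 μ) :
    ∃ e : ι → Y → ℂ, (∀ i, Measurable (e i)) ∧
      (∀ᵐ b ∂μ.map p, IsPartialOrthonormal (κ b) e) ∧
      (∀ i, InRelSpan μ p e (φ i)) ∧ ∀ i, InRelSpan μ p φ (e i) := by
  classical
  -- Process the indices one at a time; the functions not yet constructed are kept equal to zero.
  suffices H : ∀ t : Finset ι, ∃ e : ι → Y → ℂ, (∀ i, Measurable (e i)) ∧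
      (∀ᵐ b ∂μ.map p, IsPartialOrthonormal (κ b) e) ∧ (∀ i ∉ t, e i = 0) ∧
      (∀ i ∈ t, InRelSpan μ p e (φ i)) ∧ ∀ i, InRelSpan μ p φ (e i) by
    obtain ⟨e, h1, h2, -, h3, h4⟩ := H Finset.univ
    exact ⟨e, h1, h2, fun i => h3 i (Finset.mem_univ i), h4⟩
  intro t
  induction t using Finset.induction_on with
  | empty =>
    refine ⟨0, fun i => measurable_const, Filter.Eventually.of_forall fun b => ⟨fun i => ?_,
      fun i j _ => by simp, fun i => Or.inr (by rfl)⟩, fun i _ => rfl, by simp, fun i => ?_⟩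
    · exact MemLp.zero
    · exact ⟨0, fun i => measurable_const, by simp; rfl⟩
  | insert a t ha ih =>
    obtain ⟨e, hem, he, he0, hφe, heφ⟩ := ih
    obtain ⟨w, A, s, hwm, hA, hs, hw, hfw, hwb⟩ := exists_gramSchmidt_step hκ hem he (hφm a) (hφ a)
    refine ⟨Function.update e a w, fun i => ?_, ?_, fun i hi => ?_, fun i hi => ?_, fun i => ?_⟩
    · by_cases hi : i = a
      · subst hi
        simpa using hwm
      · simpa [hi] using hem i
    · filter_upwards [he, hwb] with b h1 h2
      exact h1.update h2.1 h2.2.1 h2.2.2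
    · rw [Finset.mem_insert, not_or] at hi
      rw [Function.update_of_ne hi.1, he0 i hi.2]
    · rcases Finset.mem_insert.1 hi with rfl | hi
      · refine ⟨Function.update A i s, fun j => ?_, ?_⟩
        · by_cases hj : j = i
          · subst hj
            simpa using hs
          · simpa [hj] using hA j
        · filter_upwards [hfw] with x hx
          have h1 : ∀ j, Function.update A i s j (p x) * Function.update e i w j x
              = A j (p x) * e j x + if j = i then s (p x) * w x else 0 := by
            intro j
            by_cases hj : j = i
            · subst hj
              simp [he0 j ha]
            · simp [hj]
          simp_rw [h1, Finset.sum_add_distrib]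
          rw [hx]
          simp
      · exact (hφe i hi).update (he0 a ha) w
    · by_cases hi : i = a
      · subst hi
        rw [Function.update_self, funext hw]
        exact ((InRelSpan.self i).sub (InRelSpan.trans heφ ⟨A, hA, Filter.EventuallyEq.rfl⟩)).base_mul
          (a := fun b => (s b)⁻¹) hs.inv
      · rw [Function.update_of_ne hi]
        exact heφ i

end Span

/-! ### Invariance of the kernel of the fibrewise projection -/

theorem memLp_two_iff_lintegral {Y : Type*} [MeasurableSpace Y] {ρ : Measure Y} {f : Y → ℂ}
    (hf : Measurable f) : MemLp f 2 ρ ↔ ∫⁻ x, ‖f x‖ₑ ^ 2 ∂ρ < ∞ := by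
  have h1 : ∀ x, ‖f x‖ₑ ^ 2 = ‖‖f x‖ ^ 2‖ₑ := fun x => by simp [enorm_pow]
  rw [memLp_two_iff_integrable_sq_norm hf.aestronglyMeasurable]
  simp_rw [h1]
  exact ⟨fun h => h.2, fun h => ⟨(hf.norm.pow_const 2).aestronglyMeasurable, h⟩⟩

theorem IsPartialOrthonormal.lintegral_le_one {Y : Type*} [MeasurableSpace Y] {ρ : Measure Y}
    {ι : Type*} {e : ι → Y → ℂ} (he : IsPartialOrthonormal ρ e) (i : ι) :
    ∫⁻ x, ‖e i x‖ₑ ^ 2 ∂ρ ≤ 1 := by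
  rcases he.norm_or_zero i with h | h
  · rw [integral_conj_mul_self, Complex.ofReal_eq_one] at h
    have h1 := ofReal_integral_norm_eq_lintegral_enorm
      ((he.memLp i).integrable_norm_pow (by norm_num : (2 : ℕ) ≠ 0))
    simp only [norm_pow, norm_norm, enorm_pow, enorm_norm] at h1
    rw [← h1, h, ENNReal.ofReal_one]
  · rw [lintegral_congr_ae (g := 0)]
    · simp
    · filter_upwards [h] with x hx
      simp [hx]

section Joining

variable {Y β : Type*} [MeasurableSpace Y] [MeasurableSpace β] {μ : Measure Y}
  [IsProbabilityMeasure μ] {p : Y → β} {κ : Kernel β Y} [IsMarkovKernel κ]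
  {ι : Type*} [Fintype ι] {e : ι → Y → ℂ}

theorem measurable_projKernel (hem : ∀ i, Measurable (e i)) : Measurable (projKernel e) :=
  Finset.measurable_sum _ fun i _ => ((hem i).comp measurable_fst).mul
    (Complex.continuous_conj.measurable.comp ((hem i).comp measurable_snd))

namespace IsDisintegration

omit [Fintype ι] in
theorem memLp_of_isPartialOrthonormal (hκ : IsDisintegration μ p κ) (hem : ∀ i, Measurable (e i))
    (he : ∀ᵐ b ∂μ.map p, IsPartialOrthonormal (κ b) e) (i : ι) : MemLp (e i) 2 μ := by
  have := hκ.isProbabilityMeasure_map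
  rw [memLp_two_iff_lintegral (hem i), hκ.lintegral_eq ((hem i).enorm.pow_const 2)]
  calc ∫⁻ b, ∫⁻ x, ‖e i x‖ₑ ^ 2 ∂κ b ∂μ.map p ≤ ∫⁻ _, 1 ∂μ.map p :=
        lintegral_mono_ae (he.mono fun b hb => hb.lintegral_le_one i)
    _ < ∞ := by simp

theorem memLp_tensor (hκ : IsDisintegration μ p κ) {f g : Y → ℂ} (hfm : Measurable f)
    (hgm : Measurable g) (hf : MemLp f 2 μ)
    (hg : ∀ᵐ b ∂μ.map p, ∫⁻ x, ‖g x‖ₑ ^ 2 ∂κ b ≤ 1) :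
    MemLp (fun z : Y × Y => f z.1 * g z.2) 2 (relProd (μ.map p) κ) := by
  have hm : Measurable fun z : Y × Y => f z.1 * g z.2 := by fun_prop
  rw [memLp_two_iff_lintegral hfm, hκ.lintegral_eq (hfm.enorm.pow_const 2)] at hf
  rw [memLp_two_iff_lintegral hm, relProd, Measure.lintegral_bind (Kernel.aemeasurable _)
    (hm.enorm.pow_const 2).aemeasurable]
  refine lt_of_le_of_lt (lintegral_mono_ae ?_) hf
  filter_upwards [hg] with b hb
  simp_rw [Kernel.prod_apply, enorm_mul, mul_pow]
  rw [lintegral_prod_mul (f := fun x => ‖f x‖ₑ ^ 2) (g := fun x => ‖g x‖ₑ ^ 2)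
    (hfm.enorm.pow_const 2).aemeasurable (hgm.enorm.pow_const 2).aemeasurable]
  exact mul_le_of_le_one_right' hb

theorem memLp_projKernel (hκ : IsDisintegration μ p κ) (hem : ∀ i, Measurable (e i))
    (he : ∀ᵐ b ∂μ.map p, IsPartialOrthonormal (κ b) e) :
    MemLp (projKernel e) 2 (relProd (μ.map p) κ) := by
  have h1 : ∀ i, MemLp (fun z : Y × Y => e i z.1 * conj (e i z.2)) 2 (relProd (μ.map p) κ) := by
    intro i
    refine hκ.memLp_tensor (g := fun x => conj (e i x)) (hem i)
      (Complex.continuous_conj.measurable.comp (hem i))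
      (hκ.memLp_of_isPartialOrthonormal hem he i) ?_
    filter_upwards [he] with b hb
    simpa using hb.lintegral_le_one i
  exact memLp_finsetSum Finset.univ fun i _ => h1 i

theorem integral_conj_projKernel_mul (hκ : IsDisintegration μ p κ) (hem : ∀ i, Measurable (e i))
    (he : ∀ᵐ b ∂μ.map p, IsPartialOrthonormal (κ b) e) {f : ι → Y → ℂ}
    (hf : ∀ i, MemLp (f i) 2 μ) (hfe : ∀ i, InRelSpan μ p e (f i))
    (hK : MemLp (projKernel f) 2 (relProd (μ.map p) κ)) :
    ∫ z, conj (projKernel f z) * projKernel e z ∂relProd (μ.map p) κ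
      = ∑ i, ∫ x, conj (f i x) * f i x ∂μ := by
  have hint : ∀ i, Integrable (fun x => conj (f i x) * f i x) μ := fun i =>
    (hf i).conj_mul_integrable (hf i)
  rw [hκ.integral_relProd (hK.conj_mul_integrable (hκ.memLp_projKernel hem he))]
  simp_rw [fun i => hκ.integral_eq (hint i)]
  rw [← integral_finsetSum]
  · refine integral_congr_ae ?_
    filter_upwards [he, ae_all_iff.2 fun i => hκ.ae_memLp (hf i),
      ae_all_iff.2 fun i => (hfe i).ae_fibre hκ] with b h1 h2 h3
    exact h1.integral_conj_projKernel_mul h2 h3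
  · intro i _
    have h1 := hint i
    rw [← hκ.comp_eq, Measure.comp_eq_comp_const_apply] at h1
    exact h1.integral_comp

/-- The kernel of the fibrewise projection onto an invariant span is invariant. Write `K` for the
kernel and `K'` for its translate. Invariance of the span and Parseval's identity give
`⟪K', K⟫ = ∑ i, ‖e i ∘ T‖² = ∑ i, ‖e i‖² = ‖K‖² = ‖K'‖²`, whence `‖K' - K‖² = 0`. -/
theorem projKernel_comp_ae_eq (hκ : IsDisintegration μ p κ) (hem : ∀ i, Measurable (e i))
    (he : ∀ᵐ b ∂μ.map p, IsPartialOrthonormal (κ b) e) {T : Y → Y} (hT : MeasurePreserving T μ μ)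
    (hTT : MeasurePreserving (Prod.map T T) (relProd (μ.map p) κ) (relProd (μ.map p) κ))
    (hTe : ∀ i, InRelSpan μ p e (e i ∘ T)) :
    projKernel e ∘ Prod.map T T =ᵐ[relProd (μ.map p) κ] projKernel e := by
  set ν := relProd (μ.map p) κ
  set K := projKernel e with hKdef
  set K' := projKernel e ∘ Prod.map T T with hK'def
  have hK : MemLp K 2 ν := hκ.memLp_projKernel hem he
  have hK' : MemLp K' 2 ν := hK.comp_measurePreserving hTT
  have heL := hκ.memLp_of_isPartialOrthonormal hem he
  have h1 : ∫ z, conj (K z) * K z ∂ν = ∑ i, ∫ x, conj (e i x) * e i x ∂μ :=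
    hκ.integral_conj_projKernel_mul hem he heL (fun i => InRelSpan.self i) hK
  have h2 : ∫ z, conj (K' z) * K z ∂ν = ∫ z, conj (K z) * K z ∂ν := by
    rw [h1]
    refine (hκ.integral_conj_projKernel_mul hem he (f := fun i => e i ∘ T)
      (fun i => (heL i).comp_measurePreserving hT) hTe hK').trans ?_
    refine Finset.sum_congr rfl fun i _ => ?_
    have hm : Measurable fun x => conj (e i x) * e i x :=
      (Complex.continuous_conj.measurable.comp (hem i)).mul (hem i)
    have h3 := integral_map hT.aemeasurable (μ := μ) hm.aestronglyMeasurable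
    rw [hT.map_eq] at h3
    exact h3.symm
  have h3 : ∫ z, conj (K' z) * K' z ∂ν = ∫ z, conj (K z) * K z ∂ν := by
    have hKm := measurable_projKernel hem
    have hm : Measurable fun z => conj (K z) * K z :=
      (Complex.continuous_conj.measurable.comp hKm).mul hKm
    have h4 := integral_map hTT.aemeasurable (μ := ν) hm.aestronglyMeasurable
    rw [hTT.map_eq] at h4
    exact h4.symm
  have h4 : ∫ z, conj (K z) * K' z ∂ν = ∫ z, conj (K z) * K z ∂ν := by
    rw [← conj_integral_conj_mul, h2, conj_integral_conj_mul]
  have h5 : ∫ z, conj (K' z - K z) * (K' z - K z) ∂ν = 0 := by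
    have h6 : ∀ z, conj (K' z - K z) * (K' z - K z)
        = (conj (K' z) * K' z - conj (K' z) * K z)
          - (conj (K z) * K' z - conj (K z) * K z) := fun z => by
      rw [map_sub]
      ring
    simp_rw [h6]
    rw [integral_sub, integral_sub, integral_sub, h2, h3, h4]
    · ring
    all_goals
      first
      | exact MemLp.conj_mul_integrable ‹_› ‹_›
      | exact (MemLp.conj_mul_integrable ‹_› ‹_›).sub (MemLp.conj_mul_integrable ‹_› ‹_›)
  rw [integral_conj_mul_self (ρ := ν) (fun z => K' z - K z), Complex.ofReal_eq_zero] at h5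
  filter_upwards [ae_eq_zero_of_integral_norm_sq_eq_zero (hK'.sub hK) h5] with z hz
  exact sub_eq_zero.1 hz

/-- The reproducing property of the fibrewise projection, paired with a function `f`. -/
theorem integral_conj_projKernel_mul_mul (hκ : IsDisintegration μ p κ)
    (he : ∀ᵐ b ∂μ.map p, IsPartialOrthonormal (κ b) e)
    {m f : Y → ℂ} (hm : MemLp m 2 μ) (hf : MemLp f 2 μ) (hme : InRelSpan μ p e m)
    (hint : Integrable (fun z : Y × Y => conj (projKernel e z * m z.2) * f z.1)
      (relProd (μ.map p) κ)) :
    ∫ z, conj (projKernel e z * m z.2) * f z.1 ∂relProd (μ.map p) κ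
      = ∫ x, conj (m x) * f x ∂μ := by
  rw [hκ.integral_relProd hint, hκ.integral_eq (hm.conj_mul_integrable hf)]
  refine integral_congr_ae ?_
  filter_upwards [he, hκ.ae_memLp hm, hκ.ae_memLp hf, hme.ae_fibre hκ] with b h1 h2 h3 h4
  exact h1.integral_conj_projKernel_mul_mul h2 h3 h4

end IsDisintegration

end Joining

/-! ### Pullbacks and invariant functions in `L²` -/

theorem isClosed_lpMeas {Y : Type*} {𝓑 m : MeasurableSpace Y} (h : 𝓑 ≤ m) (ρ : Measure Y) :
    IsClosed (lpMeas ℂ ℂ 𝓑 2 ρ : Set (Lp ℂ 2 ρ)) :=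
  isClosed_aestronglyMeasurable h

theorem compMeasurePreserving_mem_lpMeas {Y Y' : Type*} [m : MeasurableSpace Y]
    [MeasurableSpace Y'] {μ : Measure Y} {μ' : Measure Y'} {π : Y' → Y}
    (hπ : MeasurePreserving π μ' μ) (f : Lp ℂ 2 μ) :
    Lp.compMeasurePreserving π hπ f ∈ lpMeas ℂ ℂ (m.comap π) 2 μ' := by
  rw [mem_lpMeas_iff_aestronglyMeasurable]
  exact ⟨f ∘ π, (Lp.stronglyMeasurable f).comp_measurable (comap_measurable π),
    Lp.coeFn_compMeasurePreserving f hπ⟩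

/-- Pulling back along a measure-preserving map preserves orthogonality, since every function
measurable for the pulled back σ-algebra is itself a pullback. -/
theorem compMeasurePreserving_mem_orthogonal {Y Y' : Type*} {𝓑 : MeasurableSpace Y}
    [m : MeasurableSpace Y] [MeasurableSpace Y'] {μ : Measure Y} {μ' : Measure Y'} {π : Y' → Y}
    (h𝓑 : 𝓑 ≤ m) (hπ : MeasurePreserving π μ' μ) {f : Lp ℂ 2 μ}
    (hf : f ∈ (lpMeas ℂ ℂ 𝓑 2 μ)ᗮ) :
    Lp.compMeasurePreserving π hπ f ∈ (lpMeas ℂ ℂ (𝓑.comap π) 2 μ')ᗮ := by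
  rw [Submodule.mem_orthogonal] at hf ⊢
  intro G hG
  obtain ⟨g, hg, hGg⟩ := mem_lpMeas_iff_aestronglyMeasurable.1 hG
  obtain ⟨h, hh, rfl⟩ := StronglyMeasurable.exists_eq_measurable_comp (mY := 𝓑) hg
  have hhm : AEStronglyMeasurable h μ := (hh.mono h𝓑).aestronglyMeasurable
  have hhπ : MemLp (h ∘ π) 2 μ' := (memLp_congr_ae hGg).1 (Lp.memLp G)
  have hhL : MemLp h 2 μ := by
    rw [← hπ.map_eq]
    exact (memLp_map_measure_iff (by rwa [hπ.map_eq]) hπ.aemeasurable).2 hhπ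
  have h1 : G = Lp.compMeasurePreservingₗᵢ ℂ π hπ (hhL.toLp h) := by
    refine Lp.ext ?_
    refine hGg.trans (Filter.EventuallyEq.trans ?_
      (Lp.coeFn_compMeasurePreserving (hhL.toLp h) hπ).symm)
    exact (hπ.quasiMeasurePreserving.ae_eq_comp hhL.coeFn_toLp).symm
  rw [h1]
  change inner ℂ (Lp.compMeasurePreservingₗᵢ ℂ π hπ (hhL.toLp h))
    (Lp.compMeasurePreservingₗᵢ ℂ π hπ f) = 0
  rw [LinearIsometry.inner_map_map]
  refine hf _ (mem_lpMeas_iff_aestronglyMeasurable.2 ?_)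
  exact ⟨h, hh, hhL.coeFn_toLp⟩

/-- A measurable function that is invariant up to null sets is measurable for the invariant
σ-algebra, which consists of the sets invariant up to null sets. -/
theorem measurable_inv_of_comp_ae_eq {G Y : Type*} [MeasurableSpace Y] {μ : Measure Y}
    {T : G → Y → Y} {F : Y → ℂ} (hF : Measurable F) (h : ∀ g, F ∘ T g =ᵐ[μ] F) :
    Measurable[invariantSigma μ T] F := by
  intro B hB
  refine ⟨hF hB, fun g => ?_⟩
  filter_upwards [h g] with x hx
  change (F (T g x) ∈ B) = (F x ∈ B)
  rw [show F (T g x) = F x from hx]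

/-! ### The extension and the use of satedness -/

namespace MPS

variable {G : Type v} [Group G] [TopologicalSpace G]

/-- The underlying space of `X` with the σ-algebra of sets that are invariant under the second
action. A synonym, so that the two σ-algebras belong to different types. -/
def InvBase (X : MPS.{u} G 2) : Type u := X.carrier

instance (X : MPS.{u} G 2) : MeasurableSpace X.InvBase := X.inv 1

/-- The identity as a map onto the base. -/
def toBase (X : MPS.{u} G 2) (x : X.carrier) : X.InvBase := x

theorem measurable_toBase (X : MPS.{u} G 2) : Measurable X.toBase := fun _ hA => hA.1

/-- The transformation `T 0 g`, acting on the base. -/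
def baseEquiv (X : MPS.{u} G 2) (g : G) : X.InvBase ≃ᵐ X.InvBase where
  toFun := X.T 0 g
  invFun := X.T 0 g⁻¹
  left_inv x := (X.T_mul 0 g⁻¹ g x).symm.trans ((congrArg (fun a => X.T 0 a x)
    (inv_mul_cancel g)).trans (X.T_one 0 x))
  right_inv x := (X.T_mul 0 g g⁻¹ x).symm.trans ((congrArg (fun a => X.T 0 a x)
    (mul_inv_cancel g)).trans (X.T_one 0 x))
  measurable_toFun := X.measurable_T_inv 1 0 g
  measurable_invFun := X.measurable_T_inv 1 0 g⁻¹

variable (X : MPS.{u} G 2) {κ : Kernel X.InvBase X.carrier} [IsMarkovKernel κ]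

theorem measurePreserving_prodMap_self (hκ : IsDisintegration X.μ X.toBase κ) (g : G) :
    MeasurePreserving (Prod.map (X.T 0 g) (X.T 0 g)) (relProd (X.μ.map X.toBase) κ)
      (relProd (X.μ.map X.toBase) κ) :=
  hκ.measurePreserving_prodMap (X.T_measurePreserving 0 g) (X.T_measurePreserving 0 g)
    (X.baseEquiv g) (fun _ _ => ae_eq_refl _) (fun _ _ => ae_eq_refl _)

theorem measurePreserving_prodMap_id (hκ : IsDisintegration X.μ X.toBase κ) (g : G) :
    MeasurePreserving (Prod.map (X.T 1 g) id) (relProd (X.μ.map X.toBase) κ)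
      (relProd (X.μ.map X.toBase) κ) :=
  hκ.measurePreserving_prodMap (X.T_measurePreserving 1 g) (MeasurePreserving.id _)
    (MeasurableEquiv.refl _) (fun _ hD => Filter.EventuallyEq.symm (hD.2 g))
    (fun _ _ => ae_eq_refl _)

/-- The relatively independent self-joining of `X` over the sets invariant under the second action.
The first action is diagonal; the second acts on the first coordinate only. -/
def relSquare (hκ : IsDisintegration X.μ X.toBase κ) : MPS.{u} G 2 where
  carrier := X.carrier × X.carrier
  μ := relProd (X.μ.map X.toBase) κ
  isProbabilityMeasure := hκ.isProbabilityMeasure_relProd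
  regular := hκ.regular_relProd
  T := ![fun g => Prod.map (X.T 0 g) (X.T 0 g), fun g => Prod.map (X.T 1 g) id]
  T_one := Fin.forall_fin_two.2
    ⟨fun x => by simp [Prod.map, X.T_one], fun x => by simp [Prod.map, X.T_one]⟩
  T_mul := Fin.forall_fin_two.2
    ⟨fun g h x => by simp [Prod.map, X.T_mul], fun g h x => by simp [Prod.map, X.T_mul]⟩
  T_continuous := Fin.forall_fin_two.2
    ⟨((X.T_continuous 0).comp (continuous_fst.prodMk (continuous_fst.comp continuous_snd))).prodMk
      ((X.T_continuous 0).comp (continuous_fst.prodMk (continuous_snd.comp continuous_snd))),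
    ((X.T_continuous 1).comp (continuous_fst.prodMk (continuous_fst.comp continuous_snd))).prodMk
      (continuous_snd.comp continuous_snd)⟩
  T_measurePreserving := Fin.forall_fin_two.2
    ⟨X.measurePreserving_prodMap_self hκ, X.measurePreserving_prodMap_id hκ⟩
  T_commute := by
    have hfst : ∀ {q : X.carrier → Prop}, (∀ᵐ x ∂X.μ, q x) →
        ∀ᵐ z ∂relProd (X.μ.map X.toBase) κ, q z.1 := fun {q} hq => by
      rw [← hκ.map_fst_relProd] at hq
      exact ae_of_ae_map measurable_fst.aemeasurable hq
    have h01 : ∀ g h, ∀ᵐ z ∂relProd (X.μ.map X.toBase) κ,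
        Prod.map (X.T 0 g) (X.T 0 g) (Prod.map (X.T 1 h) id z)
          = Prod.map (X.T 1 h) id (Prod.map (X.T 0 g) (X.T 0 g) z) := fun g h => by
      filter_upwards [hfst (X.T_commute 0 1 (by decide) g h)] with z hz
      exact Prod.ext hz rfl
    refine Fin.forall_fin_two.2 ⟨Fin.forall_fin_two.2 ⟨fun h => absurd rfl h, fun _ => h01⟩,
      Fin.forall_fin_two.2 ⟨fun _ g h => ?_, fun h => absurd rfl h⟩⟩
    exact (h01 h g).mono fun z hz => hz.symm

theorem isFactorMap_fst (hκ : IsDisintegration X.μ X.toBase κ) :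
    IsFactorMap (X.relSquare hκ) X Prod.fst where
  continuous := continuous_fst
  measurePreserving := ⟨measurable_fst, hκ.map_fst_relProd⟩
  intertwines := Fin.forall_fin_two.2 ⟨fun _ _ => rfl, fun _ _ => rfl⟩

theorem iSup_inv_eq : ⨆ i, X.inv i = X.inv 0 ⊔ X.inv 1 := by
  refine le_antisymm (iSup_le (Fin.forall_fin_two.2 ⟨le_sup_left, le_sup_right⟩))
    (sup_le (le_iSup X.inv 0) (le_iSup X.inv 1))

theorem inv_sup_inv_le : X.inv 0 ⊔ X.inv 1 ≤ X.measurableSpace :=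
  sup_le (fun _ hA => hA.1) fun _ hA => hA.1

omit [IsMarkovKernel κ] in
/-- Members of an `L^∞`-module over the base lie in the relative span of its generators. -/
theorem inRelSpan_of_mem {r : ℕ} {φ φ' : Fin r → X.carrier → ℂ} (hφ : ∀ i, φ i =ᵐ[X.μ] φ' i)
    {M : Set (Lp ℂ 2 X.μ)} (hM : GeneratesModule (X.inv 1) X.μ φ M) {m : Lp ℂ 2 X.μ} (hm : m ∈ M) :
    InRelSpan X.μ X.toBase φ' m := by
  obtain ⟨c, hc, hmc⟩ := (hM m).1 hm
  choose c' hc' hcc' using fun i => (hc i).2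
  refine ⟨c', fun i => (hc' i).measurable, ?_⟩
  filter_upwards [hmc, ae_all_iff.2 hcc', ae_all_iff.2 hφ] with x h1 h2 h3
  rw [h1]
  exact Finset.sum_congr rfl fun i _ => by rw [h2, h3]; rfl

/-- Let `K` be the kernel of the fibrewise projection onto the module. On the relatively independent
square, `F (x, y) = K (x, y) * m y` is the product of a function invariant under the diagonal action
and one that does not depend on the first coordinate, so satedness makes it orthogonal to
`f ∘ Prod.fst`; by the reproducing property of `K` the inner product is `⟪m, f⟫`. -/
theorem inner_eq_zero_of_isInvSated (hX : X.IsInvSated) {M : Set (Lp ℂ 2 X.μ)}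
    (hM : IsFiniteRankInvariantModule (X.inv 1) X.μ (X.T 0) (X.T_measurePreserving 0) M)
    {m : Lp ℂ 2 X.μ} (hm : m ∈ M) {f : Lp ℂ 2 X.μ}
    (hf : f ∈ (lpMeas ℂ ℂ (X.inv 0 ⊔ X.inv 1) 2 X.μ)ᗮ) : inner ℂ m f = 0 := by
  obtain ⟨⟨r, φ, hφ, hgen⟩, hinv⟩ := hM
  obtain ⟨κ, _, hκ⟩ := exists_isDisintegration X.μ X.measurable_toBase
  let φ' : Fin r → X.carrier → ℂ := fun i => (hφ i).1.mk
  have hφφ' : ∀ i, φ i =ᵐ[X.μ] φ' i := fun i => (hφ i).1.ae_eq_mk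
  have hφ'm : ∀ i, Measurable (φ' i) := fun i => (hφ i).1.stronglyMeasurable_mk.measurable
  have hφ2 : ∀ i, MemLp (φ i) 2 X.μ := fun i => (hφ i).mono_exponent le_top
  have hφ'2 : ∀ i, MemLp (φ' i) 2 X.μ := fun i => (memLp_congr_ae (hφφ' i)).1 (hφ2 i)
  obtain ⟨e, hem, he, hφe, heφ⟩ := exists_gramSchmidt hκ hφ'm hφ'2
  have hmem : ∀ i, (hφ2 i).toLp (φ i) ∈ M := by
    classical
    refine fun i => (hgen _).2 ⟨fun j _ => if j = i then 1 else 0,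
      fun j => ⟨memLp_top_const _, aestronglyMeasurable_const⟩, ?_⟩
    filter_upwards [(hφ2 i).coeFn_toLp] with x hx
    simp [hx]
  have hTφ : ∀ g i, InRelSpan X.μ X.toBase φ' (φ' i ∘ X.T 0 g) := fun g i => by
    obtain ⟨c, hcm, hc⟩ := X.inRelSpan_of_mem hφφ' hgen (hinv g _ (hmem i))
    refine ⟨c, hcm, Filter.EventuallyEq.trans ?_ hc⟩
    refine Filter.EventuallyEq.trans ?_
      (Lp.coeFn_compMeasurePreserving _ (X.T_measurePreserving 0 g)).symm
    exact (X.T_measurePreserving 0 g).quasiMeasurePreserving.ae_eq_comp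
      ((hφφ' i).symm.trans (hφ2 i).coeFn_toLp.symm)
  have hTe : ∀ g i, InRelSpan X.μ X.toBase e (e i ∘ X.T 0 g) := fun g i =>
    InRelSpan.trans hφe (InRelSpan.trans (hTφ g)
      ((heφ i).comp (X.T_measurePreserving 0 g) (X.baseEquiv g).measurable fun _ => rfl))
  have hme : InRelSpan X.μ X.toBase e m :=
    InRelSpan.trans hφe (X.inRelSpan_of_mem hφφ' hgen hm)
  have hm_top : MemLp m ⊤ X.μ := by
    obtain ⟨c, hc, hmc⟩ := (hgen m).1 hm
    refine (memLp_congr_ae hmc).2 (memLp_finsetSum _ fun i _ => ?_)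
    exact (hφ i).mul' (hc i).1
  set X' := X.relSquare hκ with hX'
  have hπ : MeasurePreserving Prod.fst X'.μ X.μ := (X.isFactorMap_fst hκ).measurePreserving
  have hsnd : MeasurePreserving Prod.snd X'.μ X.μ := ⟨measurable_snd, hκ.map_snd_relProd⟩
  let K : X'.carrier → ℂ := projKernel e
  have hKm : Measurable K := measurable_projKernel hem
  have hKinv : Measurable[X'.inv 0] K := measurable_inv_of_comp_ae_eq hKm fun g =>
    hκ.projKernel_comp_ae_eq hem he (X.T_measurePreserving 0 g)
      (X.measurePreserving_prodMap_self hκ g) (hTe g)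
  have hmm : Measurable m := (Lp.stronglyMeasurable m).measurable
  have hm_inv : Measurable[X'.inv 1] fun z : X'.carrier => m z.2 :=
    measurable_inv_of_comp_ae_eq (hmm.comp measurable_snd) fun g => ae_eq_refl _
  let F : X'.carrier → ℂ := fun z => K z * m z.2
  have hF : MemLp F 2 X'.μ :=
    (hm_top.comp_measurePreserving hsnd).mul' (hκ.memLp_projKernel hem he)
  have hF_inv : Measurable[X'.maxInvFactor] F := by
    rw [maxInvFactor_eq, iSup_inv_eq]
    exact Measurable.mul (hKinv.mono le_sup_left le_rfl) (hm_inv.mono le_sup_right le_rfl)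
  have hF_mem : hF.toLp F ∈ lpMeas ℂ ℂ X'.maxInvFactor 2 X'.μ :=
    mem_lpMeas_iff_aestronglyMeasurable.2 ⟨F, hF_inv.stronglyMeasurable, hF.coeFn_toLp⟩
  have hsated := hX X' Prod.fst (X.isFactorMap_fst hκ)
    (Lp.compMeasurePreserving Prod.fst hπ f) (compMeasurePreserving_mem_lpMeas hπ f) (by
      rw [maxInvFactor_eq, iSup_inv_eq]
      exact compMeasurePreserving_mem_orthogonal X.inv_sup_inv_le hπ hf)
  have h0 := (Submodule.mem_orthogonal _ _).1 hsated _ hF_mem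
  have hfL : MemLp (f ∘ Prod.fst) 2 X'.μ := (Lp.memLp f).comp_measurePreserving hπ
  have h1 : ∫ z, conj (F z) * f z.1 ∂X'.μ = 0 := by
    refine Eq.trans ?_ ((L2.inner_def (𝕜 := ℂ) _ _).symm.trans h0)
    refine integral_congr_ae ?_
    filter_upwards [hF.coeFn_toLp, Lp.coeFn_compMeasurePreserving f hπ] with z hz hz'
    rw [hz]
    exact ((mul_comm _ _).trans (RCLike.inner_apply (F z) (f z.1)).symm).trans
      (congrArg (inner ℂ (F z)) hz').symm
  have h2 := hκ.integral_conj_projKernel_mul_mul he (Lp.memLp m) (Lp.memLp f) hme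
    (hF.conj_mul_integrable hfL)
  rw [L2.inner_def]
  refine Eq.trans ?_ (h2.symm.trans h1)
  simp [RCLike.inner_apply, mul_comm]

theorem relAlmostPeriodic_le_lpMeas (hX : X.IsInvSated) :
    relAlmostPeriodic (X.inv 1) X.μ (X.T 0) (X.T_measurePreserving 0) ≤
      lpMeas ℂ ℂ (X.inv 0 ⊔ X.inv 1) 2 X.μ := by
  have hcl := isClosed_lpMeas X.inv_sup_inv_le X.μ
  have : CompleteSpace (lpMeas ℂ ℂ (X.inv 0 ⊔ X.inv 1) 2 X.μ) := hcl.completeSpace_coe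
  refine Submodule.topologicalClosure_minimal _ (Submodule.span_le.2 ?_) hcl
  rintro m ⟨M, hM, hm⟩
  rw [SetLike.mem_coe, ← Submodule.orthogonal_orthogonal (lpMeas ℂ ℂ (X.inv 0 ⊔ X.inv 1) 2 X.μ),
    Submodule.mem_orthogonal']
  exact fun f hf => X.inner_eq_zero_of_isInvSated hX hM hm hf

/-! ### Products of invariant functions are relatively almost periodic -/

/-- For a `T 0`-invariant set `A`, the functions `c * 1_A` with `c ∈ L^∞(X.inv 1)` form an
invariant module of rank one. -/
theorem isFiniteRankInvariantModule_indicator {A : Set X.carrier} (hA : MeasurableSet[X.inv 0] A) :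
    IsFiniteRankInvariantModule (X.inv 1) X.μ (X.T 0) (X.T_measurePreserving 0)
      {f | ∃ c : Fin 1 → X.carrier → ℂ,
        (∀ i, MemLp (c i) ⊤ X.μ ∧ AEStronglyMeasurable[X.inv 1] (c i) X.μ) ∧
          f =ᵐ[X.μ] fun x => ∑ i, c i x * A.indicator (fun _ => (1 : ℂ)) x} := by
  refine ⟨⟨1, fun _ => A.indicator fun _ => 1, fun _ => ?_, fun f => Iff.rfl⟩, ?_⟩
  · exact (memLp_top_const (1 : ℂ)).indicator hA.1
  · rintro g f ⟨c, hc, hf⟩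
    have hT := X.T_measurePreserving 0 g
    refine ⟨fun i => c i ∘ X.T 0 g, fun i => ⟨(hc i).1.comp_measurePreserving hT, ?_⟩, ?_⟩
    · obtain ⟨c', hc', hcc'⟩ := (hc i).2
      exact ⟨c' ∘ X.T 0 g, hc'.comp_measurable (X.measurable_T_inv 1 0 g),
        hT.quasiMeasurePreserving.ae_eq_comp hcc'⟩
    · filter_upwards [Lp.coeFn_compMeasurePreserving f hT,
        hT.quasiMeasurePreserving.ae_eq_comp hf, hA.2 g] with x h1 h2 h3
      have h4 : X.T 0 g x ∈ A ↔ x ∈ A := iff_of_eq h3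
      rw [h1, h2]
      by_cases hx : x ∈ A
      · simp [hx, h4.2 hx]
      · have hx' := mt h4.1 hx
        simp [hx, hx']

theorem inv_sup_inv_eq_generateFrom : X.inv 0 ⊔ X.inv 1 = MeasurableSpace.generateFrom
    (Set.image2 (· ∩ ·) {A | MeasurableSet[X.inv 0] A} {B | MeasurableSet[X.inv 1] B}) := by
  refine le_antisymm (sup_le (fun A hA => ?_) fun B hB => ?_)
    (MeasurableSpace.generateFrom_le ?_)
  · exact MeasurableSpace.measurableSet_generateFrom
      ⟨A, hA, Set.univ, @MeasurableSet.univ _ (X.inv 1), Set.inter_univ A⟩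
  · exact MeasurableSpace.measurableSet_generateFrom
      ⟨Set.univ, @MeasurableSet.univ _ (X.inv 0), B, hB, Set.univ_inter B⟩
  · rintro _ ⟨A, hA, B, hB, rfl⟩
    exact MeasurableSet.inter (le_sup_left (b := X.inv 1) A hA) (le_sup_right (a := X.inv 0) B hB)

theorem isPiSystem_image2_inter : IsPiSystem
    (Set.image2 (· ∩ ·) {A | MeasurableSet[X.inv 0] A} {B | MeasurableSet[X.inv 1] B}) := by
  rintro _ ⟨A, hA, B, hB, rfl⟩ _ ⟨A', hA', B', hB', rfl⟩ -
  exact ⟨A ∩ A', @MeasurableSet.inter _ (X.inv 0) _ _ hA hA', B ∩ B',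
    @MeasurableSet.inter _ (X.inv 1) _ _ hB hB',
    Set.inter_inter_inter_comm A A' B B'⟩

/-- The indicator of `A ∩ B` belongs to the rank-one module generated by the indicator of `A`, with
the indicator of `B` as coefficient. -/
theorem indicatorConstLp_inter_mem_relAlmostPeriodic {A B : Set X.carrier}
    (hA : MeasurableSet[X.inv 0] A) (hB : MeasurableSet[X.inv 1] B) :
    indicatorConstLp 2 (hA.1.inter hB.1) (measure_ne_top X.μ _) (1 : ℂ) ∈
      relAlmostPeriodic (X.inv 1) X.μ (X.T 0) (X.T_measurePreserving 0) := by
  refine Submodule.le_topologicalClosure _ (Submodule.subset_span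
    ⟨_, X.isFiniteRankInvariantModule_indicator hA, fun _ => B.indicator 1, fun _ => ⟨?_, ?_⟩, ?_⟩)
  · exact (memLp_top_const (1 : ℂ)).indicator hB.1
  · have h1 : StronglyMeasurable[X.inv 1] (B.indicator (1 : X.carrier → ℂ)) :=
      (@stronglyMeasurable_one _ _ (X.inv 1) _ _).indicator hB
    exact ⟨_, h1, ae_eq_refl _⟩
  · filter_upwards [indicatorConstLp_coeFn (p := 2) (hs := hA.1.inter hB.1)
      (hμs := measure_ne_top X.μ (A ∩ B)) (c := (1 : ℂ))] with x hx
    rw [hx]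
    by_cases h1 : x ∈ A <;> by_cases h2 : x ∈ B <;> simp [h1, h2]

/-- By `indicatorConstLp_inter_mem_relAlmostPeriodic` this holds on the π-system of sets `A ∩ B`,
and it passes to the generated σ-algebra. -/
theorem setIntegral_eq_zero_of_mem_orthogonal {f : Lp ℂ 2 X.μ}
    (hf : f ∈ (relAlmostPeriodic (X.inv 1) X.μ (X.T 0) (X.T_measurePreserving 0))ᗮ)
    {s : Set X.carrier} (hs : MeasurableSet[X.inv 0 ⊔ X.inv 1] s) : ∫ x in s, f x ∂X.μ = 0 := by
  have hint : Integrable f X.μ := (Lp.memLp f).integrable (by norm_num)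
  have hinter : ∀ {A B : Set X.carrier}, MeasurableSet[X.inv 0] A → MeasurableSet[X.inv 1] B →
      ∫ x in A ∩ B, f x ∂X.μ = 0 := fun {A B} hA hB => by
    rw [← L2.inner_indicatorConstLp_one (𝕜 := ℂ) (hA.1.inter hB.1) (measure_ne_top X.μ _)]
    exact (Submodule.mem_orthogonal _ _).1 hf _
      (X.indicatorConstLp_inter_mem_relAlmostPeriodic hA hB)
  induction s, hs using MeasurableSpace.induction_on_inter X.inv_sup_inv_eq_generateFrom
    X.isPiSystem_image2_inter with
  | empty => simp
  | basic t ht =>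
    obtain ⟨A, hA, B, hB, rfl⟩ := ht
    exact hinter hA hB
  | compl t ht ih =>
    have h1 := integral_add_compl (X.inv_sup_inv_le t ht) hint
    have h2 := hinter (A := Set.univ) (B := Set.univ) MeasurableSet.univ MeasurableSet.univ
    rw [Set.univ_inter, setIntegral_univ] at h2
    rwa [ih, zero_add, h2] at h1
  | iUnion t hd ht ih =>
    rw [integral_iUnion (fun i => X.inv_sup_inv_le _ (ht i)) hd hint.integrableOn]
    simp [ih]

theorem indicatorConstLp_mem_relAlmostPeriodic {s : Set X.carrier}
    (hs : MeasurableSet[X.inv 0 ⊔ X.inv 1] s) (c : ℂ) :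
    indicatorConstLp 2 (X.inv_sup_inv_le s hs) (measure_ne_top X.μ s) c ∈
      relAlmostPeriodic (X.inv 1) X.μ (X.T 0) (X.T_measurePreserving 0) := by
  set V := relAlmostPeriodic (X.inv 1) X.μ (X.T 0) (X.T_measurePreserving 0)
  have hVcl : IsClosed (V : Set (Lp ℂ 2 X.μ)) := Submodule.isClosed_topologicalClosure _
  have : CompleteSpace V := hVcl.completeSpace_coe
  rw [← Submodule.orthogonal_orthogonal V, Submodule.mem_orthogonal']
  intro f hf
  rw [L2.inner_indicatorConstLp_eq_inner_setIntegral,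
    X.setIntegral_eq_zero_of_mem_orthogonal hf hs, inner_zero_right]

theorem lpMeas_le_relAlmostPeriodic :
    lpMeas ℂ ℂ (X.inv 0 ⊔ X.inv 1) 2 X.μ ≤
      relAlmostPeriodic (X.inv 1) X.μ (X.T 0) (X.T_measurePreserving 0) := by
  intro f hf
  have hcl : IsClosed (relAlmostPeriodic (X.inv 1) X.μ (X.T 0) (X.T_measurePreserving 0) :
    Set (Lp ℂ 2 X.μ)) := Submodule.isClosed_topologicalClosure _
  refine Lp.induction_stronglyMeasurable X.inv_sup_inv_le (by simp)
    (· ∈ relAlmostPeriodic (X.inv 1) X.μ (X.T 0) (X.T_measurePreserving 0)) ?_ ?_ ?_ f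
    (mem_lpMeas_iff_aestronglyMeasurable.1 hf)
  · intro c s hs _
    exact X.indicatorConstLp_mem_relAlmostPeriodic hs c
  · intro f g _ _ _ _ _ h1 h2
    exact Submodule.add_mem _ h1 h2
  · exact hcl.preimage continuous_subtype_val

end MPS

end CommutingActions

end

theorem mainTheorem7 {G : Type v} [Group G] [TopologicalSpace G] [IsTopologicalGroup G]
    (X : CommutingActions.MPS.{u, v} G 2) (hX : X.IsInvSated) : X.IsMagic :=
  le_antisymm (X.relAlmostPeriodic_le_lpMeas hX) X.lpMeas_le_relAlmostPeriodic
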